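/- Let $q\ge 1$, $k\ge 0$ and $0\le \ell<m$ be integers, and let $A$ and $B$ be systems of $m$ qudits each, with local dimension $q$, so that $\mathcal H_A\cong\mathcal H_B\cong(\mathbb C^q)^{\otimes m}$. Equip the space $\mathcal L(A^kB^k)$ of linear operators on $k$ copies $(\mathcal H_A\otimes\mathcal H_B)^{\otimes k}$ with the Hilbert–Schmidt norm $\|X\|_2=\sqrt{\operatorname{tr}(X^\dagger X)}$. For a subsystem $S$ of $AB$ (a subset of the qudits of one copy), let $$\mathcal T_S(X)=\int_{\mathcal U(S)} U^{\otimes k}\,X\,(U^{\dagger})^{\otimes k}\,dU$$ be the $k$-fold twirl over $S$, where $dU$ is the normalized Haar measure on the unitary group of $S$ and $\mathcal T_S$ acts as the identity on the remaining qudits. Put $$\mathcal P=\mathcal T_A\otimes\mathcal T_B,\qquad \mathcal Q_{\mathrm{ct}}=\mathcal T_{A^\ell B^\ell},\qquad \mathcal R=\mathcal T_{AB},$$ where $A^\ell B^\ell$ consists of the first $\ell$ qudits of $A$ and the first $\ell$ qudits of $B$ (in every copy). The subspace angle between the images of $\mathcal P$ and $\mathcal Q_{\mathrm{ct}}$ is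 $$c(\operatorname{im}\mathcal P,\operatorname{im}\mathcal Q_{\mathrm{ct}})=\|\mathcal Q_{\mathrm{ct}}\mathcal P-\mathcal R\|_{2\to2}=\sup_{X\ne0}\frac{\|\mathcal Q_{\mathrm{ct}}\mathcal P(X)-\mathcal R(X)\|_2}{\|X\|_2}.$$ Assume that $k\le\min\{q^{2\ell},q^m\}$, $k^2<2q^{2\ell}$ and $k^2\neq 2q^m$. Then $$c(\operatorname{im}\mathcal P,\operatorname{im}\mathcal Q_{\mathrm{ct}})^2\le acg\,q^{-4\ell k}\,k!^2\binom{q^{2\ell}+k-1}{k}^2-2ab\,q^{-4mk}\,k!^2\binom{q^{2m}+k-1}{k}^2+ab\,q^{-4mk}\,k!^4\binom{q^m+k-1}{k}^4,$$ with the constants $$a=\Bigl(1-\frac{k^2}{2q^m}\Bigr)^{-2},\qquad b=\exp\Bigl(-\frac{k^2}{2q^{2m}}\Bigr),\qquad c=\Bigl(1-\frac{k^2}{2q^{2\ell}}\Bigr)^{-1},\qquad g=\exp\Bigl(\frac{k^2}{q^{m-\ell}}\Bigr).$$ -/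

import Mathlib

open scoped Kronecker

noncomputable section

namespace CrossTwirl

/-! ### Haar probability measure on a unitary group -/

section Haar

variable {n : Type*} [Fintype n] [DecidableEq n]

instance unitaryGroup_measurableSpace : MeasurableSpace (Matrix.unitaryGroup n ℂ) := borel _

instance unitaryGroup_borelSpace : BorelSpace (Matrix.unitaryGroup n ℂ) := ⟨rfl⟩

instance unitaryGroup_compactSpace : CompactSpace (Matrix.unitaryGroup n ℂ) := by
  apply isCompact_iff_compactSpace.mp
  have hK : IsCompact
      (Set.pi Set.univ fun _ : n => Set.pi Set.univ fun _ : n => Metric.closedBall (0 : ℂ) 1) :=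
    isCompact_univ_pi fun _ => isCompact_univ_pi fun _ => isCompact_closedBall _ _
  refine IsCompact.of_isClosed_subset (X := Matrix n n ℂ) hK ?_ ?_
  · have h : (Matrix.unitaryGroup n ℂ : Set (Matrix n n ℂ)) = {M | M * star M = 1} := by
      ext M
      exact Matrix.mem_unitaryGroup_iff
    rw [h]
    exact isClosed_eq (by fun_prop) continuous_const
  · intro M hM i _ j _
    simpa using entry_norm_bound_of_unitary hM i j

/-- The normalized Haar measure on the unitary group `U(n)`. -/
def haarU : MeasureTheory.Measure (Matrix.unitaryGroup n ℂ) :=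
  MeasureTheory.Measure.haarMeasure ⊤

instance haarU_isProbabilityMeasure :
    MeasureTheory.IsProbabilityMeasure (haarU (n := n)) :=
  ⟨MeasureTheory.Measure.haarMeasure_self⟩

end Haar

/-! ### Twirls

One copy of the system consists of qudits of local dimension `q` placed at sites `σ`, so that its
computational basis is `σ → Fin q`. Operators on `k` copies are matrices indexed by
`Fin k → (σ → Fin q)`. -/

/-- Operators on `k` copies of a system of `q`-dimensional qudits at the sites `σ`. -/
abbrev Op (σ : Type*) (q k : ℕ) : Type _ :=
  Matrix (Fin k → σ → Fin q) (Fin k → σ → Fin q) ℂ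

/-- The `k`-fold tensor power `M ⊗ ⋯ ⊗ M` of a matrix. -/
def tensorPow {ι : Type*} (k : ℕ) (M : Matrix ι ι ℂ) : Matrix (Fin k → ι) (Fin k → ι) ℂ :=
  Matrix.of fun x y => ∏ i, M (x i) (y i)

section Twirl

variable {σ : Type*} [Fintype σ] [DecidableEq σ]

/-- An operator `U` on the qudits at the sites in `S`, viewed as the operator `U ⊗ 1` on all
qudits. -/
def embed (S : Finset σ) {q : ℕ}
    (U : Matrix ({s // s ∈ S} → Fin q) ({s // s ∈ S} → Fin q) ℂ) :
    Matrix (σ → Fin q) (σ → Fin q) ℂ :=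
  (U ⊗ₖ (1 : Matrix ({s // s ∉ S} → Fin q) ({s // s ∉ S} → Fin q) ℂ)).submatrix
    (Equiv.piEquivPiSubtypeProd (· ∈ S) fun _ => Fin q)
    (Equiv.piEquivPiSubtypeProd (· ∈ S) fun _ => Fin q)

/-- `U^{⊗k} X (U†)^{⊗k}` for a unitary `U` acting on the sites in `S` of each of the `k` copies. -/
def conjAction (S : Finset σ) {q k : ℕ}
    (U : Matrix.unitaryGroup ({s // s ∈ S} → Fin q) ℂ) (X : Op σ q k) : Op σ q k :=
  tensorPow k (embed S U.1) * X * tensorPow k (embed S (U.1.conjTranspose))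

theorem continuous_conjAction (S : Finset σ) {q k : ℕ} (X : Op σ q k) :
    Continuous fun U : Matrix.unitaryGroup ({s // s ∈ S} → Fin q) ℂ => conjAction S U X := by
  have h : ∀ f : Matrix.unitaryGroup ({s // s ∈ S} → Fin q) ℂ →
      Matrix ({s // s ∈ S} → Fin q) ({s // s ∈ S} → Fin q) ℂ, Continuous f →
      Continuous fun U => tensorPow k (embed S (f U)) := by
    intro f hf
    refine continuous_matrix fun x y => ?_
    simp only [tensorPow, embed, Matrix.of_apply, Matrix.submatrix_apply, Matrix.kroneckerMap_apply]
    refine continuous_finsetProd _ fun i _ => ?_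
    exact (hf.matrix_elem _ _).mul continuous_const
  exact ((h _ continuous_subtype_val).matrix_mul continuous_const).matrix_mul
    (h _ continuous_subtype_val.matrix_conjTranspose)

theorem integrable_conjAction (S : Finset σ) {q k : ℕ} (X : Op σ q k)
    (x y : Fin k → σ → Fin q) :
    MeasureTheory.Integrable
      (fun U : Matrix.unitaryGroup ({s // s ∈ S} → Fin q) ℂ => conjAction S U X x y) haarU :=
  ((continuous_conjAction S X).matrix_elem x y).integrable_of_hasCompactSupport
    (HasCompactSupport.of_compactSpace _)

/-- The `k`-fold Haar twirl over the qudits at the sites in `S`,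
`X ↦ ∫ U^{⊗k} X (U†)^{⊗k} dU` (entrywise integral), acting as the identity channel on the remaining
qudits. -/
def twirl (S : Finset σ) (q k : ℕ) : Op σ q k →ₗ[ℂ] Op σ q k where
  toFun X := Matrix.of fun x y =>
    ∫ U : Matrix.unitaryGroup ({s // s ∈ S} → Fin q) ℂ, conjAction S U X x y ∂haarU
  map_add' X Y := by
    ext x y
    simp only [Matrix.of_apply, Matrix.add_apply]
    rw [← MeasureTheory.integral_add (integrable_conjAction S X x y)
      (integrable_conjAction S Y x y)]
    simp only [conjAction, Matrix.mul_add, Matrix.add_mul, Matrix.add_apply]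
  map_smul' c X := by
    ext x y
    simp only [Matrix.of_apply, Matrix.smul_apply, RingHom.id_apply]
    rw [← MeasureTheory.integral_smul]
    simp only [conjAction, Matrix.mul_smul, Matrix.smul_mul, Matrix.smul_apply]

end Twirl

/-! ### The bipartite protocol

The sites are `Fin m ⊕ Fin m`: the left summand is `A`, the right summand is `B`. -/

/-- The qudits of the system `A`. -/
def sitesA (m : ℕ) : Finset (Fin m ⊕ Fin m) := Finset.univ.filter fun s => s.isLeft

/-- The qudits of the system `B`. -/
def sitesB (m : ℕ) : Finset (Fin m ⊕ Fin m) := Finset.univ.filter fun s => s.isRight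

/-- The first `l` qudits of `A` together with the first `l` qudits of `B`. -/
def sitesFirst (m l : ℕ) : Finset (Fin m ⊕ Fin m) :=
  Finset.univ.filter fun s => (Sum.elim (fun i => i) (fun i => i) s : Fin m).val < l

/-- `T_A ⊗ T_B = (T_A ⊗ id) ∘ (id ⊗ T_B)`. -/
def productTwirl (q m k : ℕ) : Op (Fin m ⊕ Fin m) q k →ₗ[ℂ] Op (Fin m ⊕ Fin m) q k :=
  twirl (sitesA m) q k ∘ₗ twirl (sitesB m) q k

/-- The crosstwirl: the joint twirl over the first `l` qudits of `A` and of `B`. -/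
def crossTwirl (q m l k : ℕ) : Op (Fin m ⊕ Fin m) q k →ₗ[ℂ] Op (Fin m ⊕ Fin m) q k :=
  twirl (sitesFirst m l) q k

/-- The full twirl `T_{AB}`. -/
def fullTwirl (q m k : ℕ) : Op (Fin m ⊕ Fin m) q k →ₗ[ℂ] Op (Fin m ⊕ Fin m) q k :=
  twirl Finset.univ q k

/-- The operator norm `sup_{X ≠ 0} ‖Φ X‖ / ‖X‖` of a linear map on a finite-dimensional space. -/
def opNorm {E : Type*} [NormedAddCommGroup E] [NormedSpace ℂ E] [FiniteDimensional ℂ E]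
    (Φ : E →ₗ[ℂ] E) : ℝ :=
  ‖LinearMap.toContinuousLinearMap Φ‖

section SubspaceAngle

attribute [local instance] Matrix.frobeniusNormedAddCommGroup Matrix.frobeniusNormedSpace

/-- The subspace angle `c(im P, im Q) = ‖Q P - R‖_{2→2}` of the product twirl `P` and the
crosstwirl `Q`, where `R` is the full twirl; the norm is induced by the Hilbert-Schmidt
(Frobenius) norm on operators. -/
def subspaceAngle (q m l k : ℕ) : ℝ :=
  opNorm (crossTwirl q m l k ∘ₗ productTwirl q m k - fullTwirl q m k)

end SubspaceAngle

end CrossTwirl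

end

/-!
The twirl over `S` is a Haar average of unitary conjugations, hence the orthogonal projection onto
the commutant of `{U^{⊗k}}`. When `k ≤ q ^ |S|`, this commutant is spanned over the operators off
`S` by the permutations of the `k` copies: commuting with all `U^{⊗k}` is a polynomial condition, so
it extends to all `M^{⊗k}`, and then the column at an injective tuple determines the operator.

An operator invariant under the twirls over `A` and `B` is therefore a sum of terms
`c (π, τ) • π ⊗ τ`. Its diagonal part `π = τ` is fixed by every twirl and cancels in `𝒬 - ℛ`: only
the terms with `π ≠ τ` count. Injective tuples also make the permutation operators nearly
orthogonal, which controls `∑ |c|²` at the cost of falling factorials, whereas the Gram matrix of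
the permutation operators counts tuples fixed by permutations, so by Burnside's lemma its row sums
are rising factorials, and these bound the off-diagonal terms through the Schur test. The term
`π = τ`, absent from the sum over `A^ℓ B^ℓ`, is what is subtracted in the final estimate.

If `k² > 2 q ^ m` the estimate of the falling factorials is void, but then the trivial bound
`c(im 𝒫, im 𝒬) ≤ 1` is enough.
-/

noncomputable section

namespace CrossTwirl

open scoped Matrix InnerProductSpace ComplexConjugate

attribute [local instance] Matrix.frobeniusNormedAddCommGroup Matrix.frobeniusNormedSpace

section HilbertSchmidt

variable {m n : Type*} [Fintype m] [Fintype n]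

theorem trace_conjTranspose_mul (X Y : Matrix m n ℂ) :
    (Xᴴ * Y).trace = ∑ i, ∑ j, conj (X i j) * Y i j := by
  simp only [Matrix.trace, Matrix.diag_apply, Matrix.mul_apply, Matrix.conjTranspose_apply,
    Complex.star_def]
  exact Finset.sum_comm

theorem frobenius_norm_sq (X : Matrix m n ℂ) : ‖X‖ ^ 2 = ∑ i, ∑ j, ‖X i j‖ ^ 2 := by
  rw [Matrix.frobenius_norm_def, ← Real.sqrt_eq_rpow, Real.sq_sqrt (by positivity)]
  norm_cast

/-- The Hilbert–Schmidt inner product `⟪X, Y⟫ = tr (Xᴴ Y)`; the norm it induces is the Frobenius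
norm. -/
@[reducible]
def hilbertSchmidtInnerProductSpace : InnerProductSpace ℂ (Matrix m n ℂ) where
  inner X Y := (Xᴴ * Y).trace
  norm_sq_eq_re_inner X := by
    rw [frobenius_norm_sq, trace_conjTranspose_mul]
    simp only [Complex.conj_mul', map_sum]
    norm_cast
  conj_inner_symm X Y := by
    simp only [trace_conjTranspose_mul, map_sum, map_mul, Complex.conj_conj, mul_comm]
  add_left X Y Z := by rw [Matrix.conjTranspose_add, Matrix.add_mul, Matrix.trace_add]
  smul_left X Y c := by
    rw [Matrix.conjTranspose_smul, Matrix.smul_mul, Matrix.trace_smul, smul_eq_mul,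
      Complex.star_def]

end HilbertSchmidt

attribute [local instance] hilbertSchmidtInnerProductSpace

section UnitaryReindex

theorem submatrix_equiv_mem_unitaryGroup {m n : Type*} [Fintype m] [Fintype n] [DecidableEq m]
    [DecidableEq n] {U : Matrix n n ℂ} (hU : U ∈ Matrix.unitaryGroup n ℂ) (e : m ≃ n) :
    U.submatrix e e ∈ Matrix.unitaryGroup m ℂ := by
  rw [Matrix.mem_unitaryGroup_iff, Matrix.star_eq_conjTranspose, Matrix.conjTranspose_submatrix,
    Matrix.submatrix_mul_equiv, ← Matrix.star_eq_conjTranspose, Matrix.mem_unitaryGroup_iff.1 hU,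
    Matrix.submatrix_one_equiv]

end UnitaryReindex

section HilbertSchmidtInner

variable {m n : Type*} [Fintype m] [Fintype n]

theorem inner_eq_sum (X Y : Matrix m n ℂ) : ⟪X, Y⟫_ℂ = ∑ i, ∑ j, conj (X i j) * Y i j :=
  trace_conjTranspose_mul X Y

theorem inner_submatrix_equiv {m' n' : Type*} [Fintype m'] [Fintype n'] (X Y : Matrix m n ℂ)
    (e : m' ≃ m) (f : n' ≃ n) : ⟪X.submatrix e f, Y.submatrix e f⟫_ℂ = ⟪X, Y⟫_ℂ := by
  simp only [inner_eq_sum, Matrix.submatrix_apply]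
  rw [← e.sum_comp]
  exact Finset.sum_congr rfl fun i _ => f.sum_comp fun j => conj (X (e i) j) * Y (e i) j

theorem inner_kronecker {m' n' : Type*} [Fintype m'] [Fintype n'] (X Y : Matrix m n ℂ)
    (X' Y' : Matrix m' n' ℂ) : ⟪X ⊗ₖ X', Y ⊗ₖ Y'⟫_ℂ = ⟪X, Y⟫_ℂ * ⟪X', Y'⟫_ℂ := by
  change ((X ⊗ₖ X')ᴴ * (Y ⊗ₖ Y')).trace = (Xᴴ * Y).trace * (X'ᴴ * Y').trace
  rw [Matrix.conjTranspose_kronecker, ← Matrix.mul_kronecker_mul, Matrix.trace_kronecker]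

theorem norm_unitary_mul_mul [DecidableEq m] [DecidableEq n] (X : Matrix m n ℂ)
    {U : Matrix m m ℂ} {V : Matrix n n ℂ} (hU : U ∈ Matrix.unitaryGroup m ℂ)
    (hV : V ∈ Matrix.unitaryGroup n ℂ) : ‖U * X * V‖ = ‖X‖ := by
  rw [norm_eq_sqrt_re_inner (𝕜 := ℂ), norm_eq_sqrt_re_inner (𝕜 := ℂ)]
  congr 2
  calc ((U * X * V)ᴴ * (U * X * V)).trace = (Vᴴ * (Xᴴ * (Uᴴ * U) * X * V)).trace := by
        simp only [Matrix.conjTranspose_mul, Matrix.mul_assoc]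
    _ = (Xᴴ * X * (V * Vᴴ)).trace := by
        rw [← Matrix.star_eq_conjTranspose U, Matrix.mem_unitaryGroup_iff'.1 hU, Matrix.mul_one,
          Matrix.trace_mul_comm, Matrix.mul_assoc]
    _ = (Xᴴ * X).trace := by
        rw [← Matrix.star_eq_conjTranspose V, Matrix.mem_unitaryGroup_iff.1 hV, Matrix.mul_one]

end HilbertSchmidtInner

section HaarAveraging

variable {𝕜 G E : Type*} [RCLike 𝕜] [Group G] [TopologicalSpace G] [CompactSpace G]
  [MeasurableSpace G] [BorelSpace G] [NormedAddCommGroup E] [InnerProductSpace 𝕜 E]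
  [NormedSpace ℝ E] [CompleteSpace E]

open MeasureTheory

theorem integral_eq_starProjection_invariants [ContinuousMul G] (μ : Measure G)
    [IsProbabilityMeasure μ] [μ.IsMulLeftInvariant] (ρ : Representation 𝕜 G E)
    [ρ.invariants.HasOrthogonalProjection]
    (hnorm : ∀ g x, ‖ρ g x‖ = ‖x‖) (hcont : ∀ x, Continuous fun g => ρ g x) (x : E) :
    ∫ g, ρ g x ∂μ = ρ.invariants.starProjection x := by
  have hint : Integrable (fun g => ρ g x) μ :=
    (hcont x).integrable_of_hasCompactSupport (HasCompactSupport.of_compactSpace _)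
  let isom (g : G) : E →ₗᵢ[𝕜] E := ⟨ρ g, hnorm g⟩
  symm
  refine Submodule.eq_starProjection_of_mem_orthogonal (fun h => ?_)
    ((Submodule.mem_orthogonal _ _).2 fun y hy => ?_)
  · calc ρ h (∫ g, ρ g x ∂μ) = ∫ g, ρ h (ρ g x) ∂μ :=
          ((isom h).toContinuousLinearMap.integral_comp_comm hint).symm
      _ = ∫ g, ρ (h * g) x ∂μ := by simp only [map_mul, Module.End.mul_apply]
      _ = ∫ g, ρ g x ∂μ := integral_mul_left_eq_self (fun g => ρ g x) h
  · have hconst (g : G) : inner 𝕜 y (ρ g x) = inner 𝕜 y x := by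
      conv_lhs => rw [← hy g]
      exact (isom g).inner_map_map y x
    rw [inner_sub_right, ← integral_inner hint]
    simp only [hconst, integral_const, probReal_univ, one_smul, sub_self]

end HaarAveraging

section TensorPow

variable {ι : Type*}

theorem tensorPow_mul [Fintype ι] (k : ℕ) (M N : Matrix ι ι ℂ) :
    tensorPow k (M * N) = tensorPow k M * tensorPow k N := by
  ext x y
  simp only [tensorPow, Matrix.of_apply, Matrix.mul_apply, ← Finset.prod_mul_distrib]
  exact Fintype.prod_sum _

theorem tensorPow_one [DecidableEq ι] (k : ℕ) : tensorPow k (1 : Matrix ι ι ℂ) = 1 := by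
  ext x y
  simp only [tensorPow, Matrix.of_apply, Matrix.one_apply, Finset.prod_ite_zero,
    Finset.mem_univ, forall_const, Finset.prod_const_one, funext_iff]

theorem tensorPow_conjTranspose (k : ℕ) (M : Matrix ι ι ℂ) :
    tensorPow k Mᴴ = (tensorPow k M)ᴴ := by
  ext x y
  simp only [tensorPow, Matrix.of_apply, Matrix.conjTranspose_apply, star_prod]

end TensorPow

section Commutant

variable {σ : Type*} [Fintype σ] [DecidableEq σ] {q k : ℕ} (S : Finset σ)

theorem embed_mul (U V : Matrix ({s // s ∈ S} → Fin q) ({s // s ∈ S} → Fin q) ℂ) :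
    embed S (U * V) = embed S U * embed S V := by
  rw [embed, embed, embed, Matrix.submatrix_mul_equiv, ← Matrix.mul_kronecker_mul, Matrix.one_mul]

theorem embed_one :
    embed S (1 : Matrix ({s // s ∈ S} → Fin q) ({s // s ∈ S} → Fin q) ℂ) = 1 := by
  rw [embed, Matrix.one_kronecker_one, Matrix.submatrix_one_equiv]

theorem embed_conjTranspose (U : Matrix ({s // s ∈ S} → Fin q) ({s // s ∈ S} → Fin q) ℂ) :
    embed S Uᴴ = (embed S U)ᴴ := by
  rw [embed, embed, Matrix.conjTranspose_submatrix, Matrix.conjTranspose_kronecker,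
    Matrix.conjTranspose_one]

/-- The multiplicative map `U ↦ (U ⊗ 1)^{⊗k}` by which the operators on the sites in `S` act on
`k` copies of the system. -/
def siteRep (k : ℕ) :
    Matrix ({s // s ∈ S} → Fin q) ({s // s ∈ S} → Fin q) ℂ →* Op σ q k where
  toFun U := tensorPow k (embed S U)
  map_one' := by rw [embed_one, tensorPow_one]
  map_mul' U V := by rw [embed_mul, tensorPow_mul]

theorem siteRep_apply (U : Matrix ({s // s ∈ S} → Fin q) ({s // s ∈ S} → Fin q) ℂ) :
    siteRep S k U = tensorPow k (embed S U) := rfl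

theorem siteRep_conjTranspose (U : Matrix ({s // s ∈ S} → Fin q) ({s // s ∈ S} → Fin q) ℂ) :
    siteRep S k Uᴴ = (siteRep S k U)ᴴ := by
  rw [siteRep_apply, embed_conjTranspose, tensorPow_conjTranspose, siteRep_apply]

theorem siteRep_mem_unitaryGroup (U : Matrix.unitaryGroup ({s // s ∈ S} → Fin q) ℂ) :
    siteRep S k U.1 ∈ Matrix.unitaryGroup (Fin k → σ → Fin q) ℂ := by
  rw [Matrix.mem_unitaryGroup_iff, Matrix.star_eq_conjTranspose, ← siteRep_conjTranspose,
    ← map_mul, ← Matrix.star_eq_conjTranspose, Matrix.mem_unitaryGroup_iff.1 U.2, map_one]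

theorem conjAction_eq (U : Matrix.unitaryGroup ({s // s ∈ S} → Fin q) ℂ) (X : Op σ q k) :
    conjAction S U X = siteRep S k U.1 * X * (siteRep S k U.1)ᴴ := by
  rw [← siteRep_conjTranspose]
  rfl

theorem norm_conjAction (U : Matrix.unitaryGroup ({s // s ∈ S} → Fin q) ℂ) (X : Op σ q k) :
    ‖conjAction S U X‖ = ‖X‖ := by
  rw [conjAction_eq]
  exact norm_unitary_mul_mul X (siteRep_mem_unitaryGroup S U)
    (Unitary.star_mem (siteRep_mem_unitaryGroup S U))

theorem conjAction_eq_self_iff (U : Matrix.unitaryGroup ({s // s ∈ S} → Fin q) ℂ) (X : Op σ q k) :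
    conjAction S U X = X ↔ Commute (siteRep S k U.1) X := by
  have hU := siteRep_mem_unitaryGroup (k := k) S U
  rw [conjAction_eq, commute_iff_eq]
  constructor <;> intro h
  · conv_rhs => rw [← h]
    rw [Matrix.mul_assoc, ← Matrix.star_eq_conjTranspose, Matrix.mem_unitaryGroup_iff'.1 hU,
      Matrix.mul_one]
  · rw [h, Matrix.mul_assoc, ← Matrix.star_eq_conjTranspose, Matrix.mem_unitaryGroup_iff.1 hU,
      Matrix.mul_one]

/-- The representation `U ↦ (X ↦ U^{⊗k} X (Uᴴ)^{⊗k})` of the unitary group of the sites in `S`;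
the twirl over `S` is its Haar average. -/
def conjRep (q k : ℕ) :
    Representation ℂ (Matrix.unitaryGroup ({s // s ∈ S} → Fin q) ℂ) (Op σ q k) where
  toFun U :=
    { toFun := conjAction S U
      map_add' := fun X Y => by simp only [conjAction, Matrix.mul_add, Matrix.add_mul]
      map_smul' := fun c X => by
        simp only [conjAction, Matrix.mul_smul, Matrix.smul_mul, RingHom.id_apply] }
  map_one' := LinearMap.ext fun X => (conjAction_eq_self_iff S 1 X).2 <| by
    rw [Submonoid.coe_one, map_one]
    exact Commute.one_left X
  map_mul' U V := LinearMap.ext fun X => by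
    change conjAction S (U * V) X = conjAction S U (conjAction S V X)
    simp only [conjAction_eq, Submonoid.coe_mul, map_mul, Matrix.conjTranspose_mul,
      Matrix.mul_assoc]

theorem conjRep_apply (U : Matrix.unitaryGroup ({s // s ∈ S} → Fin q) ℂ) (X : Op σ q k) :
    conjRep S q k U X = conjAction S U X := rfl

/-- The operators on `k` copies that commute with `U^{⊗k}` for every unitary `U` on the sites in
`S`: the image of the twirl over `S`. -/
def commutant (q k : ℕ) : Submodule ℂ (Op σ q k) := (conjRep S q k).invariants

variable {S}

theorem mem_commutant {X : Op σ q k} :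
    X ∈ commutant S q k ↔
      ∀ U : Matrix.unitaryGroup ({s // s ∈ S} → Fin q) ℂ, Commute (siteRep S k U.1) X :=
  forall_congr' fun U => conjAction_eq_self_iff S U X

instance {n : Type*} [Fintype n] [DecidableEq n] :
    MeasureTheory.Measure.IsMulLeftInvariant (haarU (n := n)) := by
  unfold haarU
  infer_instance

instance : (commutant S q k).HasOrthogonalProjection :=
  @Submodule.HasOrthogonalProjection.ofCompleteSpace ℂ (Op σ q k) _ _ _ (commutant S q k)
    (FiniteDimensional.complete ℂ _)

instance : (conjRep S q k).invariants.HasOrthogonalProjection :=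
  inferInstanceAs (commutant S q k).HasOrthogonalProjection

theorem map_integral_conjRep {E : Type*} [NormedAddCommGroup E] [NormedSpace ℂ E] [CompleteSpace E]
    (T : Op σ q k →ₗ[ℂ] E) (X : Op σ q k) :
    T (∫ U, conjRep S q k U X ∂haarU) = ∫ U, T (conjRep S q k U X) ∂haarU := by
  have hint := Continuous.integrable_of_hasCompactSupport (μ := haarU) (E := Op σ q k)
    (continuous_conjAction S X) (HasCompactSupport.of_compactSpace _)
  exact ((LinearMap.toContinuousLinearMap T).integral_comp_comm hint).symm

theorem twirl_eq_integral_conjRep (X : Op σ q k) :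
    twirl S q k X = ∫ U, conjRep S q k U X ∂haarU := by
  ext x y
  exact (map_integral_conjRep (Matrix.entryLinearMap ℂ ℂ x y) X).symm

theorem twirl_eq_starProjection (X : Op σ q k) :
    twirl S q k X = (commutant S q k).starProjection X := by
  rw [twirl_eq_integral_conjRep]
  exact integral_eq_starProjection_invariants haarU (conjRep S q k) (norm_conjAction S)
    (continuous_conjAction S) X

end Commutant

section Split

variable {σ : Type*} [DecidableEq σ] {q k : ℕ} (S : Finset σ)

/-- Configurations of `k` copies, split into their restrictions to `S` and to its complement. -/
def splitEquiv (q k : ℕ) :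
    (Fin k → σ → Fin q) ≃ (Fin k → {s // s ∈ S} → Fin q) × (Fin k → {s // s ∉ S} → Fin q) :=
  ((Equiv.refl (Fin k)).arrowCongr
    (Equiv.piEquivPiSubtypeProd (· ∈ S) fun _ => Fin q)).trans
    (Equiv.arrowProdEquivProdArrow (Fin k) _ _)

/-- The tensor product `X ⊗ Y` of an operator on `k` copies of the sites in `S` and one on `k`
copies of the remaining sites. -/
def siteTensor (X : Op {s // s ∈ S} q k) (Y : Op {s // s ∉ S} q k) : Op σ q k :=
  (X ⊗ₖ Y).submatrix (splitEquiv S q k) (splitEquiv S q k)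

theorem siteTensor_mul [Fintype σ] (X X' : Op {s // s ∈ S} q k) (Y Y' : Op {s // s ∉ S} q k) :
    siteTensor S (X * X') (Y * Y') = siteTensor S X Y * siteTensor S X' Y' := by
  rw [siteTensor, siteTensor, siteTensor, Matrix.submatrix_mul_equiv, Matrix.mul_kronecker_mul]

theorem siteTensor_smul_left (c : ℂ) (X : Op {s // s ∈ S} q k) (Y : Op {s // s ∉ S} q k) :
    siteTensor S (c • X) Y = c • siteTensor S X Y := by
  rw [siteTensor, Matrix.smul_kronecker, Matrix.submatrix_smul, siteTensor]
  rfl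

theorem siteTensor_sum_smul_right {J : Type*} [Fintype J] (c : J → ℂ) (X : Op {s // s ∈ S} q k)
    (Y : J → Op {s // s ∉ S} q k) :
    siteTensor S X (∑ j, c j • Y j) = ∑ j, c j • siteTensor S X (Y j) := by
  ext x y
  simp only [siteTensor, Matrix.submatrix_apply, Matrix.kroneckerMap_apply, Matrix.sum_apply,
    Matrix.smul_apply, smul_eq_mul, Finset.mul_sum, mul_left_comm]

theorem inner_siteTensor [Fintype σ] (X X' : Op {s // s ∈ S} q k) (Y Y' : Op {s // s ∉ S} q k) :
    ⟪siteTensor S X Y, siteTensor S X' Y'⟫_ℂ = ⟪X, X'⟫_ℂ * ⟪Y, Y'⟫_ℂ := by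
  rw [siteTensor, siteTensor, inner_submatrix_equiv, inner_kronecker]

theorem tensorPow_embed [Fintype σ] (U : Matrix ({s // s ∈ S} → Fin q) ({s // s ∈ S} → Fin q) ℂ) :
    tensorPow k (embed S U) = siteTensor S (tensorPow k U) 1 := by
  rw [← tensorPow_one]
  ext x y
  simp only [tensorPow, embed, siteTensor, Matrix.of_apply, Matrix.submatrix_apply,
    Matrix.kroneckerMap_apply, Finset.prod_mul_distrib]
  rfl

/-- Configurations of the sites in `Sᶜ`, as configurations of the sites not in `S`. -/
def complEquiv [Fintype σ] (q : ℕ) : ({s // s ∉ S} → Fin q) ≃ ({s // s ∈ Sᶜ} → Fin q) :=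
  (Equiv.subtypeEquivRight fun _ => Finset.mem_compl.symm).arrowCongr (Equiv.refl (Fin q))

theorem tensorPow_embed_compl [Fintype σ]
    (V : Matrix ({s // s ∈ Sᶜ} → Fin q) ({s // s ∈ Sᶜ} → Fin q) ℂ) :
    tensorPow k (embed Sᶜ V) =
      siteTensor S 1 (tensorPow k (V.submatrix (complEquiv S q) (complEquiv S q))) := by
  rw [← tensorPow_one]
  ext x y
  simp only [tensorPow, embed, siteTensor, Matrix.of_apply, Matrix.submatrix_apply,
    Matrix.kroneckerMap_apply, ← Finset.prod_mul_distrib]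
  refine Finset.prod_congr rfl fun i _ => (mul_comm _ _).trans (congrArg (· * _) ?_)
  simp only [Matrix.one_apply, Equiv.piEquivPiSubtypeProd_apply, funext_iff, Subtype.forall,
    Finset.mem_compl, not_not]
  rfl

theorem commute_siteRep_compl [Fintype σ]
    (U : Matrix ({s // s ∈ S} → Fin q) ({s // s ∈ S} → Fin q) ℂ)
    (V : Matrix ({s // s ∈ Sᶜ} → Fin q) ({s // s ∈ Sᶜ} → Fin q) ℂ) :
    Commute (siteRep S k U) (siteRep Sᶜ k V) := by
  rw [siteRep_apply, siteRep_apply, tensorPow_embed, tensorPow_embed_compl, commute_iff_eq,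
    ← siteTensor_mul, ← siteTensor_mul, Matrix.mul_one, Matrix.one_mul, Matrix.mul_one,
    Matrix.one_mul]

end Split

section Twirl

variable {σ : Type*} [Fintype σ] [DecidableEq σ] {q k : ℕ} {S : Finset σ}

theorem twirl_mem_commutant (X : Op σ q k) : twirl S q k X ∈ commutant S q k := by
  rw [twirl_eq_starProjection]
  exact Submodule.starProjection_apply_mem _ X

theorem twirl_eq_self {X : Op σ q k} (hX : X ∈ commutant S q k) : twirl S q k X = X := by
  rw [twirl_eq_starProjection, Submodule.starProjection_eq_self_iff.2 hX]

theorem norm_twirl_le (X : Op σ q k) : ‖twirl S q k X‖ ≤ ‖X‖ := by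
  rw [twirl_eq_starProjection]
  exact Submodule.norm_starProjection_apply_le _ X

theorem inner_twirl_left (X Y : Op σ q k) : ⟪twirl S q k X, Y⟫_ℂ = ⟪X, twirl S q k Y⟫_ℂ := by
  rw [twirl_eq_starProjection, twirl_eq_starProjection,
    Submodule.inner_starProjection_left_eq_right]

theorem map_twirl (T : Op σ q k →ₗ[ℂ] Op σ q k) (X : Op σ q k)
    (hT : ∀ U, T (conjAction S U X) = conjAction S U (T X)) :
    T (twirl S q k X) = twirl S q k (T X) := by
  rw [twirl_eq_integral_conjRep, twirl_eq_integral_conjRep, map_integral_conjRep]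
  exact congrArg _ (funext hT)

theorem twirl_mem_commutant_compl {X : Op σ q k} (hX : X ∈ commutant Sᶜ q k) :
    twirl S q k X ∈ commutant Sᶜ q k := fun V => by
  refine (map_twirl (conjRep Sᶜ q k V) X fun U => ?_).trans (congrArg (twirl S q k) (hX V))
  have hUV : siteRep Sᶜ k V.1 * siteRep S k U.1 = siteRep S k U.1 * siteRep Sᶜ k V.1 :=
    (commute_siteRep_compl S U.1 V.1).symm
  have hUV' := congrArg Matrix.conjTranspose hUV
  rw [Matrix.conjTranspose_mul, Matrix.conjTranspose_mul] at hUV'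
  simp only [conjRep_apply, conjAction_eq, Matrix.mul_assoc, hUV']
  simp only [← Matrix.mul_assoc, hUV]

theorem commutant_univ_le : commutant Finset.univ q k ≤ commutant S q k := by
  intro X hX
  rw [mem_commutant] at hX ⊢
  intro U
  let e : ({s // s ∈ (Finset.univ : Finset σ)} → Fin q) ≃ (σ → Fin q) :=
    (Equiv.subtypeUnivEquiv Finset.mem_univ).arrowCongr (Equiv.refl _)
  have hU : embed S U.1 ∈ Matrix.unitaryGroup (σ → Fin q) ℂ := by
    rw [Matrix.mem_unitaryGroup_iff, Matrix.star_eq_conjTranspose, ← embed_conjTranspose,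
      ← embed_mul, ← Matrix.star_eq_conjTranspose, Matrix.mem_unitaryGroup_iff.1 U.2, embed_one]
  have hembed : embed Finset.univ ((embed S U.1).submatrix e e) = embed S U.1 := by
    ext x y
    have : IsEmpty {s // s ∉ (Finset.univ : Finset σ)} := ⟨fun s => s.2 (Finset.mem_univ _)⟩
    exact (congrArg _ (if_pos (Subsingleton.elim _ _))).trans (mul_one _)
  have hcomm := hX ⟨_, submatrix_equiv_mem_unitaryGroup hU e⟩
  rwa [siteRep_apply, hembed] at hcomm

theorem twirl_univ_twirl (X : Op σ q k) :
    twirl Finset.univ q k (twirl S q k X) = twirl Finset.univ q k X := by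
  rw [twirl_eq_starProjection, twirl_eq_starProjection, twirl_eq_starProjection,
    ← ContinuousLinearMap.comp_apply,
    Submodule.starProjection_comp_starProjection_of_le commutant_univ_le]

theorem norm_twirl_sub_twirl_univ_le (X : Op σ q k) :
    ‖twirl S q k X - twirl Finset.univ q k X‖ ≤ ‖twirl S q k X‖ := by
  rw [← twirl_univ_twirl (S := S) X, twirl_eq_starProjection (S := Finset.univ),
    ← Submodule.starProjection_orthogonal_val]
  exact Submodule.norm_starProjection_apply_le _ _

theorem norm_twirl_sub_twirl_univ_le_norm_twirl_sub (X : Op σ q k) {W : Op σ q k}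
    (hW : W ∈ commutant Finset.univ q k) :
    ‖twirl S q k X - twirl Finset.univ q k X‖ ≤ ‖twirl S q k (X - W)‖ := by
  have hsub : twirl S q k X - twirl Finset.univ q k X =
      twirl S q k (X - W) - twirl Finset.univ q k (X - W) := by
    rw [map_sub, map_sub, twirl_eq_self hW, twirl_eq_self (commutant_univ_le hW),
      sub_sub_sub_cancel_right]
  rw [hsub]
  exact norm_twirl_sub_twirl_univ_le _

end Twirl

section PermutationOperators

variable {ι : Type*} [DecidableEq ι] {k : ℕ}

theorem tensorPow_diagonal (u : ι → ℂ) :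
    tensorPow k (Matrix.diagonal u) = Matrix.diagonal fun z => ∏ i, u (z i) := by
  ext x y
  simp only [tensorPow, Matrix.of_apply, Matrix.diagonal_apply, Finset.prod_ite_zero,
    Finset.mem_univ, forall_const, funext_iff]

theorem tensorPow_ite (f : ι → ι) :
    tensorPow k (Matrix.of fun a b => if a = f b then 1 else 0) =
      Matrix.of fun x y => if x = f ∘ y then 1 else 0 := by
  ext x y
  simp only [tensorPow, Matrix.of_apply, Finset.prod_ite_zero, Finset.mem_univ, forall_const,
    Finset.prod_const_one, funext_iff, Function.comp_apply]

theorem exists_perm_of_card_fiber_eq {α : Type*} [Fintype α] {f g : α → ι}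
    (h : ∀ b, Fintype.card {a // f a = b} = Fintype.card {a // g a = b}) :
    ∃ π : Equiv.Perm α, f = g ∘ π :=
  ⟨Equiv.ofFiberEquiv fun b => Fintype.equivOfCardEq (h b),
    funext fun a => (Equiv.ofFiberEquiv_map _ a).symm⟩

/-- The permutation operator sending `e_y` to `e_{y ∘ π}`. -/
def copyPerm (ι : Type*) [DecidableEq ι] (π : Equiv.Perm (Fin k)) :
    Matrix (Fin k → ι) (Fin k → ι) ℂ :=
  Matrix.of fun x y => if x = y ∘ π then 1 else 0

theorem commute_tensorPow_copyPerm [Fintype ι] (M : Matrix ι ι ℂ) (π : Equiv.Perm (Fin k)) :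
    Commute (tensorPow k M) (copyPerm ι π) := by
  ext x y
  have hperm (z : Fin k → ι) : x = z ∘ π ↔ z = x ∘ π.symm := by
    rw [eq_comm, ← Equiv.eq_comp_symm]
  simp only [copyPerm, tensorPow, Matrix.mul_apply, Matrix.of_apply, hperm, mul_ite, ite_mul,
    mul_one, mul_zero, one_mul, zero_mul, Finset.sum_ite_eq', Finset.mem_univ, if_true,
    Function.comp_apply]
  exact Fintype.prod_equiv π _ _ fun i => by rw [Equiv.symm_apply_apply]

end PermutationOperators

section SchurWeyl

variable {ι : Type*} [Fintype ι] {k : ℕ} {X : Matrix (Fin k → ι) (Fin k → ι) ℂ}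

theorem commute_tensorPow_of_infinite {J : Type*} (B : ι → ι → MvPolynomial J ℂ)
    (s : J → Set ℂ) (hs : ∀ j, (s j).Infinite)
    (h : ∀ u, (∀ j, u j ∈ s j) →
      Commute (tensorPow k (Matrix.of fun a b => (B a b).eval u)) X) (u : J → ℂ) :
    Commute (tensorPow k (Matrix.of fun a b => (B a b).eval u)) X := by
  ext x y
  let p : MvPolynomial J ℂ := ∑ z, (∏ i, B (x i) (z i)) * MvPolynomial.C (X z y)
  let r : MvPolynomial J ℂ := ∑ z, MvPolynomial.C (X x z) * ∏ i, B (z i) (y i)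
  have hp (u : J → ℂ) :
      p.eval u = (tensorPow k (Matrix.of fun a b => (B a b).eval u) * X) x y := by
    simp only [p, map_sum, map_mul, map_prod, MvPolynomial.eval_C]
    rfl
  have hr (u : J → ℂ) :
      r.eval u = (X * tensorPow k (Matrix.of fun a b => (B a b).eval u)) x y := by
    simp only [r, map_sum, map_mul, map_prod, MvPolynomial.eval_C]
    rfl
  have hpr : p = r := MvPolynomial.funext_set s hs fun v hv => by
    rw [hp, hr, (h v fun j => hv j (Set.mem_univ j)).eq]
  rw [← hp, ← hr, hpr]

theorem infinite_unit_circle : (Metric.sphere (0 : ℂ) 1).Infinite :=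
  (isPreconnected_sphere (by simp only [Complex.rank_real_complex, Nat.one_lt_ofNat]) 0
    1).infinite_of_nontrivial ⟨1, by simp, -1, by simp, by norm_num⟩

theorem exists_perm_of_apply_ne_zero (h : ∀ M : Matrix ι ι ℂ, Commute (tensorPow k M) X)
    {x y : Fin k → ι} (hxy : X x y ≠ 0) : ∃ π : Equiv.Perm (Fin k), x = y ∘ π := by
  classical
  refine exists_perm_of_card_fiber_eq fun b => ?_
  have hweight (u : ι → ℂ) : ∏ i, u (x i) = ∏ i, u (y i) := by
    have hentry := congrFun (congrFun (h (Matrix.diagonal u)).eq x) y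
    rw [tensorPow_diagonal, Matrix.diagonal_mul, Matrix.mul_diagonal, mul_comm] at hentry
    exact mul_left_cancel₀ hxy hentry
  have hpow := hweight fun a => if a = b then 2 else 1
  simp only [Finset.prod_ite, Finset.prod_const, one_pow, mul_one] at hpow
  rw [Fintype.card_subtype, Fintype.card_subtype]
  exact Nat.pow_right_injective le_rfl (by exact_mod_cast hpow)

variable [DecidableEq ι]

theorem commute_tensorPow_conj_diagonal
    (h : ∀ U : Matrix.unitaryGroup ι ℂ, Commute (tensorPow k U.1) X)
    (V : Matrix.unitaryGroup ι ℂ) (u : ι → ℂ) :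
    Commute (tensorPow k (V.1 * Matrix.diagonal u * star V.1)) X := by
  let B (a b : ι) : MvPolynomial ι ℂ :=
    ∑ j, MvPolynomial.C (V.1 a j * star V.1 j b) * MvPolynomial.X j
  have hB (u : ι → ℂ) :
      (Matrix.of fun a b => (B a b).eval u) = V.1 * Matrix.diagonal u * star V.1 := by
    ext a b
    simp only [B, Matrix.of_apply, map_sum, map_mul, MvPolynomial.eval_C, MvPolynomial.eval_X,
      Matrix.mul_apply (M := V.1 * _), Matrix.mul_diagonal, mul_right_comm]
  rw [← hB]
  refine commute_tensorPow_of_infinite B (fun _ => Metric.sphere 0 1)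
    (fun _ => infinite_unit_circle) (fun u hu => ?_) u
  have hdiag : Matrix.diagonal u ∈ Matrix.unitaryGroup ι ℂ := by
    rw [Matrix.mem_unitaryGroup_iff, Matrix.star_eq_conjTranspose, Matrix.diagonal_conjTranspose,
      Matrix.diagonal_mul_diagonal, ← Matrix.diagonal_one]
    refine congrArg _ (funext fun j => ?_)
    rw [Pi.star_apply, Complex.star_def, Complex.mul_conj', mem_sphere_zero_iff_norm.1 (hu j)]
    norm_num
  rw [hB]
  exact h ⟨_, mul_mem (mul_mem V.2 hdiag) (star V).2⟩

theorem commute_tensorPow_of_isHermitian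
    (h : ∀ U : Matrix.unitaryGroup ι ℂ, Commute (tensorPow k U.1) X)
    {H : Matrix ι ι ℂ} (hH : H.IsHermitian) : Commute (tensorPow k H) X := by
  have hspec := hH.spectral_theorem
  rw [Unitary.conjStarAlgAut_apply] at hspec
  rw [hspec]
  exact commute_tensorPow_conj_diagonal h hH.eigenvectorUnitary _

theorem commute_tensorPow
    (h : ∀ U : Matrix.unitaryGroup ι ℂ, Commute (tensorPow k U.1) X) (M : Matrix ι ι ℂ) :
    Commute (tensorPow k M) X := by
  -- `R + t S` is Hermitian for real `t`, and the identity in `t` persists at `t = i`.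
  let R : Matrix ι ι ℂ := realPart M
  let S : Matrix ι ι ℂ := imaginaryPart M
  let B (a b : ι) : MvPolynomial Unit ℂ :=
    MvPolynomial.C (R a b) + MvPolynomial.X () * MvPolynomial.C (S a b)
  have hB (u : Unit → ℂ) : (Matrix.of fun a b => (B a b).eval u) = R + u () • S := by
    ext a b
    simp only [B, Matrix.of_apply, map_add, map_mul, MvPolynomial.eval_C, MvPolynomial.eval_X,
      Matrix.add_apply, Matrix.smul_apply, smul_eq_mul]
  have key := commute_tensorPow_of_infinite (X := X) B (fun _ => Set.range ((↑) : ℝ → ℂ))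
    (fun _ => Set.infinite_range_of_injective Complex.ofReal_injective) (fun u hu => by
      obtain ⟨t, ht⟩ := hu ()
      rw [hB, ← ht]
      refine commute_tensorPow_of_isHermitian h ?_
      have hR : Rᴴ = R := (realPart M).2
      have hS : Sᴴ = S := (imaginaryPart M).2
      rw [Matrix.IsHermitian, Matrix.conjTranspose_add, Matrix.conjTranspose_smul, hR, hS,
        Complex.star_def, Complex.conj_ofReal]) fun _ => Complex.I
  rwa [hB, realPart_add_I_smul_imaginaryPart] at key

theorem eq_sum_smul_copyPerm (h : ∀ M : Matrix ι ι ℂ, Commute (tensorPow k M) X)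
    {x₀ : Fin k → ι} (hx₀ : Function.Injective x₀) :
    X = ∑ π : Equiv.Perm (Fin k), X (x₀ ∘ π) x₀ • copyPerm ι π := by
  ext x y
  -- Commutation with the matrix of `f`, which sends `x₀` to `y`, reads column `y` of `X` off
  -- column `x₀`, whose only nonzero entries are at permutations of `x₀`.
  let f : ι → ι := Function.extend x₀ y id
  have hf : f ∘ x₀ = y := Function.extend_comp hx₀ y id
  have hentry := congrFun (congrFun (h (Matrix.of fun a b => if a = f b then 1 else 0)).eq x) x₀
  simp only [tensorPow_ite, Matrix.mul_apply, Matrix.of_apply, hf, mul_ite, mul_one, mul_zero,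
    Finset.sum_ite_eq', Finset.mem_univ, if_true] at hentry
  have hinj : Function.Injective fun π : Equiv.Perm (Fin k) => x₀ ∘ π := fun π π' hπ =>
    Equiv.ext fun i => hx₀ (congrFun hπ i)
  rw [← hentry, Matrix.sum_apply]
  refine (Fintype.sum_of_injective _ hinj _ _ (fun z hz => ?_) fun π => ?_).symm
  · by_contra hne
    obtain ⟨π, rfl⟩ := exists_perm_of_apply_ne_zero h (right_ne_zero_of_mul hne)
    exact hz ⟨π, rfl⟩
  · rw [Matrix.smul_apply, copyPerm, Matrix.of_apply, ← Function.comp_assoc, hf, smul_eq_mul,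
      mul_comm]

end SchurWeyl

section NearOrthogonality

variable {ι : Type*} [DecidableEq ι] {k : ℕ}

theorem sum_smul_copyPerm_apply (c : Equiv.Perm (Fin k) → ℂ) {y : Fin k → ι}
    (hy : Function.Injective y) (π : Equiv.Perm (Fin k)) :
    (∑ τ, c τ • copyPerm ι τ) (y ∘ π) y = c π := by
  have hinj (τ : Equiv.Perm (Fin k)) : y ∘ π = y ∘ τ ↔ π = τ := by
    rw [hy.comp_left.eq_iff, DFunLike.coe_fn_eq]
  simp only [Matrix.sum_apply, Matrix.smul_apply, copyPerm, Matrix.of_apply, hinj, smul_eq_mul,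
    mul_ite, mul_one, mul_zero, Finset.sum_ite_eq, Finset.mem_univ, if_true]

theorem descFactorial_mul_sum_le_norm_sum_smul_copyPerm_sq [Fintype ι]
    (c : Equiv.Perm (Fin k) → ℂ) :
    ((Fintype.card ι).descFactorial k : ℝ) * ∑ π, ‖c π‖ ^ 2 ≤
      ‖∑ π, c π • copyPerm ι π‖ ^ 2 := by
  let Y : Matrix (Fin k → ι) (Fin k → ι) ℂ := ∑ π, c π • copyPerm ι π
  have hcolumn (y : Fin k → ι) (hy : Function.Injective y) :
      ∑ π, ‖c π‖ ^ 2 ≤ ∑ x, ‖Y x y‖ ^ 2 := by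
    let e : Equiv.Perm (Fin k) ↪ (Fin k → ι) :=
      ⟨fun π => y ∘ π, fun π π' h => DFunLike.coe_injective (hy.comp_left h)⟩
    calc ∑ π, ‖c π‖ ^ 2 = ∑ x ∈ Finset.univ.map e, ‖Y x y‖ ^ 2 := by
          rw [Finset.sum_map]
          exact Finset.sum_congr rfl fun π _ =>
            congrArg (‖·‖ ^ 2) (sum_smul_copyPerm_apply c hy π).symm
      _ ≤ ∑ x, ‖Y x y‖ ^ 2 :=
          Finset.sum_le_univ_sum_of_nonneg fun _ => by positivity
  have hcard : (Fintype.card ι).descFactorial k =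
      (Finset.univ.filter fun y : Fin k → ι => Function.Injective y).card := by
    rw [← Fintype.card_subtype, Fintype.card_congr (Equiv.subtypeInjectiveEquivEmbedding _ _),
      Fintype.card_embedding_eq, Fintype.card_fin]
  rw [frobenius_norm_sq, Finset.sum_comm, hcard, ← nsmul_eq_mul, ← Finset.sum_const]
  calc ∑ _y with Function.Injective _y, ∑ π, ‖c π‖ ^ 2
      ≤ ∑ y : Fin k → ι with Function.Injective y, ∑ x, ‖Y x y‖ ^ 2 :=
        Finset.sum_le_sum fun y hy => hcolumn y (Finset.mem_filter.1 hy).2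
    _ ≤ ∑ y, ∑ x, ‖Y x y‖ ^ 2 := Finset.sum_le_univ_sum_of_nonneg fun _ => by positivity

end NearOrthogonality

section Blocks

variable {σ : Type*} [DecidableEq σ] {q k : ℕ} (S : Finset σ)

/-- The partial matrix element `(1 ⊗ ⟨u|) X (1 ⊗ |v⟩)`, an operator on the sites in `S`. -/
def siteBlock (X : Op σ q k) (u v : Fin k → {s // s ∉ S} → Fin q) : Op {s // s ∈ S} q k :=
  Matrix.of fun x y => X ((splitEquiv S q k).symm (x, u)) ((splitEquiv S q k).symm (y, v))

/-- The partial matrix element `(⟨x| ⊗ 1) X (|y⟩ ⊗ 1)`, an operator on the sites not in `S`. -/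
def coBlock (X : Op σ q k) (x y : Fin k → {s // s ∈ S} → Fin q) : Op {s // s ∉ S} q k :=
  Matrix.of fun u v => X ((splitEquiv S q k).symm (x, u)) ((splitEquiv S q k).symm (y, v))

variable {S}

theorem card_config (q : ℕ) :
    Fintype.card ({s // s ∈ S} → Fin q) = q ^ S.card := by
  rw [Fintype.card_fun, Fintype.card_fin, Fintype.card_coe]

theorem siteBlock_siteTensor (M : Op {s // s ∈ S} q k) (N : Op {s // s ∉ S} q k)
    (u v : Fin k → {s // s ∉ S} → Fin q) :
    siteBlock S (siteTensor S M N) u v = N u v • M := by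
  ext x y
  simp only [siteBlock, siteTensor, Matrix.of_apply, Matrix.submatrix_apply,
    Equiv.apply_symm_apply, Matrix.kroneckerMap_apply, Matrix.smul_apply, smul_eq_mul, mul_comm]

theorem ext_siteBlock (S : Finset σ) {X Y : Op σ q k}
    (h : ∀ u v, siteBlock S X u v = siteBlock S Y u v) :
    X = Y := by
  ext x y
  have hentry := congrFun₂ (h (splitEquiv S q k x).2 (splitEquiv S q k y).2)
    (splitEquiv S q k x).1 (splitEquiv S q k y).1
  simpa only [siteBlock, Matrix.of_apply, Prod.mk.eta, Equiv.symm_apply_apply] using hentry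

theorem siteBlock_sum {J : Type*} [Fintype J] (X : J → Op σ q k)
    (u v : Fin k → {s // s ∉ S} → Fin q) :
    siteBlock S (∑ j, X j) u v = ∑ j, siteBlock S (X j) u v := by
  ext x y
  simp only [siteBlock, Matrix.sum_apply, Matrix.of_apply]

variable [Fintype σ]

theorem commute_siteBlock {M : Op {s // s ∈ S} q k} {X : Op σ q k}
    (h : Commute (siteTensor S M 1) X) (u v : Fin k → {s // s ∉ S} → Fin q) :
    Commute M (siteBlock S X u v) := by
  ext x y
  have hentry := congrFun (congrFun h.eq ((splitEquiv S q k).symm (x, u)))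
    ((splitEquiv S q k).symm (y, v))
  simp only [Matrix.mul_apply, ← (splitEquiv S q k).symm.sum_comp, Fintype.sum_prod_type,
    siteTensor, Matrix.submatrix_apply, Equiv.apply_symm_apply, Matrix.kroneckerMap_apply,
    Matrix.one_apply, mul_ite, ite_mul, mul_one, mul_zero, zero_mul, Finset.sum_ite_eq,
    Finset.sum_ite_eq', Finset.mem_univ, if_true] at hentry
  exact hentry

theorem commute_coBlock {M : Op {s // s ∉ S} q k} {X : Op σ q k}
    (h : Commute (siteTensor S 1 M) X) (x y : Fin k → {s // s ∈ S} → Fin q) :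
    Commute M (coBlock S X x y) := by
  ext u v
  have hentry := congrFun (congrFun h.eq ((splitEquiv S q k).symm (x, u)))
    ((splitEquiv S q k).symm (y, v))
  simp only [Matrix.mul_apply, ← (splitEquiv S q k).symm.sum_comp, Fintype.sum_prod_type_right,
    siteTensor, Matrix.submatrix_apply, Equiv.apply_symm_apply, Matrix.kroneckerMap_apply,
    Matrix.one_apply, mul_ite, ite_mul, one_mul, mul_zero, zero_mul, Finset.sum_ite_eq,
    Finset.sum_ite_eq', Finset.mem_univ, if_true] at hentry
  exact hentry

theorem norm_sq_eq_sum_siteBlock (S : Finset σ) (X : Op σ q k) :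
    ‖X‖ ^ 2 = ∑ u, ∑ v, ‖siteBlock S X u v‖ ^ 2 := by
  simp only [frobenius_norm_sq, ← (splitEquiv S q k).symm.sum_comp, Fintype.sum_prod_type_right]
  refine Finset.sum_congr rfl fun u _ => ?_
  rw [Finset.sum_comm]
  rfl

theorem descFactorial_mul_sum_le_norm_sum_siteTensor_copyPerm_sq
    (C : Equiv.Perm (Fin k) → Op {s // s ∉ S} q k) :
    ((q ^ S.card).descFactorial k : ℝ) * ∑ π, ‖C π‖ ^ 2 ≤
      ‖∑ π, siteTensor S (copyPerm _ π) (C π)‖ ^ 2 := by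
  have hC : ∑ π, ‖C π‖ ^ 2 = ∑ u, ∑ v, ∑ π, ‖C π u v‖ ^ 2 := by
    simp only [frobenius_norm_sq]
    rw [Finset.sum_comm]
    exact Finset.sum_congr rfl fun _ _ => Finset.sum_comm
  rw [hC, norm_sq_eq_sum_siteBlock S]
  simp only [siteBlock_sum, siteBlock_siteTensor, Finset.mul_sum]
  refine Finset.sum_le_sum fun u _ => Finset.sum_le_sum fun v _ => ?_
  rw [← Finset.mul_sum, ← card_config]
  exact descFactorial_mul_sum_le_norm_sum_smul_copyPerm_sq _

theorem eq_sum_siteTensor_of_mem_commutant {X : Op σ q k} (hX : X ∈ commutant S q k)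
    {x₀ : Fin k → {s // s ∈ S} → Fin q} (hx₀ : Function.Injective x₀) :
    X = ∑ π : Equiv.Perm (Fin k), siteTensor S (copyPerm _ π) (coBlock S X (x₀ ∘ π) x₀) := by
  refine ext_siteBlock S fun u v => ?_
  have hcomm := commute_tensorPow fun U => commute_siteBlock (M := tensorPow k U.1)
    (by simpa only [siteRep_apply, tensorPow_embed] using mem_commutant.1 hX U) u v
  rw [eq_sum_smul_copyPerm hcomm hx₀, siteBlock_sum]
  simp only [siteBlock_siteTensor]
  rfl

theorem commute_tensorPow_coBlock {X : Op σ q k} (hX : X ∈ commutant Sᶜ q k)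
    (x y : Fin k → {s // s ∈ S} → Fin q)
    (M : Matrix ({s // s ∉ S} → Fin q) ({s // s ∉ S} → Fin q) ℂ) :
    Commute (tensorPow k M) (coBlock S X x y) := by
  refine commute_tensorPow (fun U => ?_) M
  let e := (complEquiv S q).symm
  have hcomm := mem_commutant.1 hX ⟨_, submatrix_equiv_mem_unitaryGroup U.2 e⟩
  rw [siteRep_apply, tensorPow_embed_compl, Matrix.submatrix_submatrix, Equiv.symm_comp_self,
    Matrix.submatrix_id_id] at hcomm
  exact commute_coBlock hcomm x y

end Blocks

section Counting

variable {k : ℕ}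

/-- The number of tuples on which `σ` and `τ` act in the same way; it is the Hilbert–Schmidt inner
product of the permutation operators of `σ` and `τ`. -/
def agreeCount (ι : Type*) [Fintype ι] [DecidableEq ι] (σ τ : Equiv.Perm (Fin k)) : ℕ :=
  Fintype.card {z : Fin k → ι // z ∘ σ = z ∘ τ}

variable {ι : Type*} [Fintype ι] [DecidableEq ι]

theorem agreeCount_congr {κ : Type*} [Fintype κ] [DecidableEq κ] (e : ι ≃ κ)
    (σ τ : Equiv.Perm (Fin k)) : agreeCount ι σ τ = agreeCount κ σ τ :=
  Fintype.card_congr ((Equiv.arrowCongr (Equiv.refl _) e).subtypeEquiv fun _ =>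
    (e.injective.comp_left (α := Fin k).eq_iff).symm)

theorem agreeCount_comm (σ τ : Equiv.Perm (Fin k)) : agreeCount ι σ τ = agreeCount ι τ σ :=
  Fintype.card_congr (Equiv.subtypeEquivRight fun _ => eq_comm)

theorem agreeCount_self (σ : Equiv.Perm (Fin k)) : agreeCount ι σ σ = Fintype.card ι ^ k := by
  rw [agreeCount, Fintype.card_congr (Equiv.subtypeUnivEquiv fun _ => rfl), Fintype.card_fun,
    Fintype.card_fin]

theorem agreeCount_eq_one_left (σ τ : Equiv.Perm (Fin k)) :
    agreeCount ι σ τ = agreeCount ι 1 (τ * σ⁻¹) :=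
  Fintype.card_congr (Equiv.subtypeEquivRight fun z => (Equiv.eq_comp_symm σ z (z ∘ τ)).symm)

theorem card_forall_agree {T : Type*} [Fintype T] [DecidableEq T]
    (p p' : T → Equiv.Perm (Fin k)) :
    Fintype.card {y : Fin k → T → ι // ∀ s i, y (p s i) s = y (p' s i) s} =
      ∏ s, agreeCount ι (p s) (p' s) := by
  simp only [agreeCount]
  rw [← Fintype.card_pi]
  exact Fintype.card_congr <| ((Equiv.piComm fun (_ : Fin k) (_ : T) => ι).subtypeEquiv
    (q := fun y : T → Fin k → ι => ∀ s, y s ∘ p s = y s ∘ p' s)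
      fun _ => forall_congr' fun _ => funext_iff.symm).trans
    (Equiv.subtypePiEquivPi (p := fun s (z : Fin k → ι) => z ∘ p s = z ∘ p' s))

theorem agreeCount_fun (T : Type*) [Fintype T] [DecidableEq T] (σ τ : Equiv.Perm (Fin k)) :
    agreeCount (T → ι) σ τ = agreeCount ι σ τ ^ Fintype.card T := by
  rw [← Finset.card_univ, ← Finset.prod_const, ← card_forall_agree]
  refine Fintype.card_congr (Equiv.subtypeEquivRight fun z => ?_)
  simp only [funext_iff, Function.comp_apply]
  exact forall_comm

theorem agreeCount_fin_pow (q n : ℕ) (σ τ : Equiv.Perm (Fin k)) :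
    agreeCount (Fin (q ^ n)) σ τ = agreeCount (Fin q) σ τ ^ n := by
  rw [← agreeCount_congr finFunctionFinEquiv, agreeCount_fun, Fintype.card_fin]

end Counting

section Burnside

variable {k : ℕ} {ι : Type*}

/-- The unordered tuple underlying a tuple. -/
def tupleSym (z : Fin k → ι) : Sym ι k :=
  ⟨Finset.univ.val.map z, by rw [Multiset.card_map, Finset.card_val, Finset.card_fin]⟩

theorem tupleSym_surjective : Function.Surjective (tupleSym : (Fin k → ι) → Sym ι k) := by
  rintro ⟨s, rfl⟩
  induction s using Quotient.inductionOn with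
  | h l => exact ⟨l.get, Subtype.ext ((Fin.univ_val_map l.get).trans
      (congrArg _ (List.ofFn_get l)))⟩

theorem tupleSym_comp_perm (z : Fin k → ι) (π : Equiv.Perm (Fin k)) :
    tupleSym (z ∘ π) = tupleSym z := Subtype.ext <| by
  change Finset.univ.val.map (z ∘ π) = Finset.univ.val.map z
  rw [← Multiset.map_map, Multiset.map_univ_val_equiv]

theorem tupleSym_eq_iff {z z' : Fin k → ι} :
    tupleSym z = tupleSym z' ↔ ∃ π : Equiv.Perm (Fin k), z = z' ∘ π := by
  classical
  refine ⟨fun h => exists_perm_of_card_fiber_eq fun b => ?_, ?_⟩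
  · have hcount := congrArg (Multiset.count b) (congrArg Subtype.val h)
    simp only [tupleSym, Multiset.count_map, eq_comm (a := b)] at hcount
    rw [Fintype.card_subtype, Fintype.card_subtype]
    exact hcount
  · rintro ⟨π, rfl⟩
    exact tupleSym_comp_perm z' π

/-- The orbits of tuples under permutations of positions are the unordered tuples. -/
def tupleOrbitEquivSym :
    MulAction.orbitRel.Quotient (Equiv.Perm (Fin k))ᵈᵐᵃ (Fin k → ι) ≃ Sym ι k :=
  (Quotient.congrRight fun z z' => by
    rw [MulAction.orbitRel_apply, Setoid.ker_def, tupleSym_eq_iff]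
    exact ⟨fun ⟨g, hg⟩ => ⟨DomMulAct.mk.symm g, hg.symm⟩,
      fun ⟨π, hπ⟩ => ⟨DomMulAct.mk π, hπ.symm⟩⟩).trans
    (Setoid.quotientKerEquivOfSurjective tupleSym tupleSym_surjective)

theorem sum_agreeCount [Fintype ι] [DecidableEq ι] (σ : Equiv.Perm (Fin k)) :
    ∑ τ, agreeCount ι σ τ = (Fintype.card ι).ascFactorial k := by
  classical
  let _ : Fintype (Equiv.Perm (Fin k))ᵈᵐᵃ := Fintype.ofEquiv _ DomMulAct.mk
  calc ∑ τ, agreeCount ι σ τ = ∑ π : Equiv.Perm (Fin k), agreeCount ι 1 π :=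
        Fintype.sum_equiv (Equiv.mulRight σ⁻¹) _ _ fun τ => agreeCount_eq_one_left σ τ
    _ = ∑ g : (Equiv.Perm (Fin k))ᵈᵐᵃ, Fintype.card (MulAction.fixedBy (Fin k → ι) g) :=
        Fintype.sum_equiv DomMulAct.mk _ _ fun π =>
          Fintype.card_congr (Equiv.subtypeEquivRight fun _ => eq_comm)
    _ = Fintype.card (Sym ι k) * k.factorial := by
        rw [MulAction.sum_card_fixedBy_eq_card_orbits_mul_card_group,
          Fintype.card_congr tupleOrbitEquivSym, ← Fintype.card_congr DomMulAct.mk,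
          Fintype.card_perm, Fintype.card_fin]
    _ = (Fintype.card ι).ascFactorial k := by
        rw [Sym.card_sym_eq_choose, mul_comm, Nat.ascFactorial_eq_factorial_mul_choose']

theorem sum_agreeCount_mul_agreeCount_add_le [Fintype ι] [DecidableEq ι]
    {σ τ : Equiv.Perm (Fin k)} (h : σ ≠ τ) :
    ∑ π, agreeCount ι π σ * agreeCount ι π τ + (Fintype.card ι ^ k) ^ 2 ≤
      (Fintype.card ι).ascFactorial k ^ 2 := by
  have htotal : ∑ τ', ∑ π, agreeCount ι π σ * agreeCount ι π τ' =
      (Fintype.card ι).ascFactorial k ^ 2 := by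
    rw [Finset.sum_comm]
    simp only [← Finset.mul_sum, sum_agreeCount, ← Finset.sum_mul, agreeCount_comm _ σ, sq]
  have hdiag : (Fintype.card ι ^ k) ^ 2 ≤ ∑ π, agreeCount ι π σ * agreeCount ι π σ := by
    rw [sq, ← agreeCount_self σ]
    exact Finset.single_le_sum (f := fun π => agreeCount ι π σ * agreeCount ι π σ)
      (fun _ _ => Nat.zero_le _) (Finset.mem_univ σ)
  calc _ ≤ ∑ π, agreeCount ι π σ * agreeCount ι π τ + ∑ π, agreeCount ι π σ * agreeCount ι π σ :=
        Nat.add_le_add_left hdiag _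
    _ = ∑ τ' ∈ {τ, σ}, ∑ π, agreeCount ι π σ * agreeCount ι π τ' :=
        (Finset.sum_pair (f := fun τ' => ∑ π, agreeCount ι π σ * agreeCount ι π τ') h.symm).symm
    _ ≤ ∑ τ', ∑ π, agreeCount ι π σ * agreeCount ι π τ' :=
        Finset.sum_le_sum_of_subset (Finset.subset_univ _)
    _ = _ := htotal

end Burnside

section SchurTest

theorem norm_sum_smul_sq_le {𝕜 E J : Type*} [RCLike 𝕜] [SeminormedAddCommGroup E]
    [InnerProductSpace 𝕜 E] [Fintype J] (w : J → 𝕜) (b : J → E) {M : ℝ}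
    (hM : ∀ i, ∑ j, ‖⟪b i, b j⟫_𝕜‖ ≤ M) : ‖∑ i, w i • b i‖ ^ 2 ≤ M * ∑ i, ‖w i‖ ^ 2 := by
  let G (i j : J) : ℝ := ‖⟪b i, b j⟫_𝕜‖
  have hsymm : ∑ i, ∑ j, G i j * ‖w j‖ ^ 2 = ∑ i, ∑ j, G i j * ‖w i‖ ^ 2 := by
    rw [Finset.sum_comm]
    exact Finset.sum_congr rfl fun i _ => Finset.sum_congr rfl fun j _ =>
      congrArg (· * _) (norm_inner_symm _ _)
  calc ‖∑ i, w i • b i‖ ^ 2 = ‖∑ i, ∑ j, ⟪w i • b i, w j • b j⟫_𝕜‖ := by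
        simp only [← inner_sum, ← sum_inner, inner_self_eq_norm_sq_to_K, norm_pow,
          RCLike.norm_ofReal, abs_norm]
    _ ≤ ∑ i, ∑ j, ‖⟪w i • b i, w j • b j⟫_𝕜‖ :=
        (norm_sum_le _ _).trans (Finset.sum_le_sum fun i _ => norm_sum_le _ _)
    _ ≤ ∑ i, ∑ j, (G i j * ‖w i‖ ^ 2 + G i j * ‖w j‖ ^ 2) / 2 := by
        refine Finset.sum_le_sum fun i _ => Finset.sum_le_sum fun j _ => ?_
        rw [inner_smul_left, inner_smul_right, norm_mul, norm_mul, RCLike.norm_conj]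
        nlinarith [mul_nonneg (norm_nonneg ⟪b i, b j⟫_𝕜) (sq_nonneg (‖w i‖ - ‖w j‖))]
    _ = ∑ i, (∑ j, G i j) * ‖w i‖ ^ 2 := by
        simp only [← Finset.sum_div, Finset.sum_add_distrib, hsymm, add_self_div_two,
          Finset.sum_mul]
    _ ≤ ∑ i, M * ‖w i‖ ^ 2 :=
        Finset.sum_le_sum fun i _ => mul_le_mul_of_nonneg_right (hM i) (sq_nonneg _)
    _ = M * ∑ i, ‖w i‖ ^ 2 := (Finset.mul_sum _ _ _).symm

theorem sum_norm_sum_smul_sq_le {𝕜 E I J : Type*} [RCLike 𝕜] [SeminormedAddCommGroup E]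
    [InnerProductSpace 𝕜 E] [Fintype I] [Fintype J] (w : I → J → 𝕜) (b : J → E) {M : ℝ} {r : J → ℝ}
    (hM : ∀ i, ∑ j, ‖⟪b i, b j⟫_𝕜‖ ≤ M) (hr : ∀ j, ∑ i, ‖w i j‖ ^ 2 ≤ r j) :
    ∑ i, ‖∑ j, w i j • b j‖ ^ 2 ≤ M * ∑ j, r j := by
  have hM0 (j : J) : 0 ≤ M := (Finset.sum_nonneg fun _ _ => norm_nonneg _).trans (hM j)
  calc ∑ i, ‖∑ j, w i j • b j‖ ^ 2 ≤ ∑ i, M * ∑ j, ‖w i j‖ ^ 2 :=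
        Finset.sum_le_sum fun i _ => norm_sum_smul_sq_le (w i) b hM
    _ = M * ∑ j, ∑ i, ‖w i j‖ ^ 2 := by rw [← Finset.mul_sum, Finset.sum_comm]
    _ ≤ M * ∑ j, r j := by
        rw [Finset.mul_sum, Finset.mul_sum]
        exact Finset.sum_le_sum fun j _ => mul_le_mul_of_nonneg_left (hr j) (hM0 j)

end SchurTest

section SitePermutations

variable {T : Type*} {k : ℕ}

/-- The operator permuting the `k` copies of the qudit at each site `s` by `p s`. -/
def sitePerm (q : ℕ) (p : T → Equiv.Perm (Fin k)) [Fintype T] : Op T q k :=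
  Matrix.of fun x y => if x = fun i s => y (p s i) s then 1 else 0

theorem copyPerm_eq_sitePerm [Fintype T] (q : ℕ) (π : Equiv.Perm (Fin k)) :
    copyPerm (T → Fin q) π = sitePerm q fun _ => π :=
  rfl

theorem siteTensor_sitePerm [DecidableEq T] [Fintype T] (S : Finset T) (q : ℕ)
    (p : T → Equiv.Perm (Fin k)) :
    siteTensor S (sitePerm q fun s => p s) (sitePerm q fun s => p s) = sitePerm q p := by
  ext x y
  simp only [siteTensor, sitePerm, Matrix.submatrix_apply, Matrix.kroneckerMap_apply,
    Matrix.of_apply, mul_ite, mul_one, mul_zero, ← ite_and]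
  refine if_congr ?_ rfl rfl
  rw [and_comm, ← (splitEquiv S q k).apply_eq_iff_eq, Prod.ext_iff]
  rfl

theorem inner_sitePerm [Fintype T] [DecidableEq T] (q : ℕ) (p p' : T → Equiv.Perm (Fin k)) :
    ⟪sitePerm q p, sitePerm q p'⟫_ℂ = ↑(∏ s, agreeCount (Fin q) (p s) (p' s)) := by
  rw [← card_forall_agree, inner_eq_sum, Finset.sum_comm, Fintype.card_subtype,
    Finset.card_filter, Nat.cast_sum]
  refine Finset.sum_congr rfl fun y _ => ?_
  simp only [sitePerm, Matrix.of_apply, apply_ite conj, map_one, map_zero, ite_mul, one_mul,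
    zero_mul, Finset.sum_ite_eq', Finset.mem_univ, if_true, Nat.cast_ite, Nat.cast_one,
    Nat.cast_zero]
  refine if_congr ?_ rfl rfl
  simp only [funext_iff]
  exact forall_comm

end SitePermutations

section TwirlBound

variable {σ J : Type*} {q k : ℕ} {S : Finset σ}

theorem exists_injective_tuple (hk : k ≤ q ^ S.card) :
    ∃ x : Fin k → {s // s ∈ S} → Fin q, Function.Injective x := by
  classical
  rw [← card_config, ← Fintype.card_fin k] at hk
  exact (Function.Embedding.nonempty_of_card_le hk).elim fun f => ⟨f, f.injective⟩

variable [DecidableEq σ] [Fintype σ] [Fintype J]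

theorem descFactorial_mul_norm_twirl_sum_sq_le (hk : k ≤ q ^ S.card)
    (A : J → Op {s // s ∈ S} q k) (B : J → Op {s // s ∉ S} q k) :
    ((q ^ S.card).descFactorial k : ℝ) * ‖twirl S q k (∑ j, siteTensor S (A j) (B j))‖ ^ 2 ≤
      ∑ π, ‖∑ j, ⟪copyPerm _ π, A j⟫_ℂ • B j‖ ^ 2 := by
  let Y := ∑ j, siteTensor S (A j) (B j)
  let E (π : Equiv.Perm (Fin k)) := ∑ j, ⟪copyPerm _ π, A j⟫_ℂ • B j
  change _ * ‖twirl S q k Y‖ ^ 2 ≤ ∑ π, ‖E π‖ ^ 2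
  have hmem := twirl_mem_commutant (S := S) Y
  obtain ⟨x₀, hx₀⟩ := exists_injective_tuple hk
  let C (π : Equiv.Perm (Fin k)) := coBlock S (twirl S q k Y) (x₀ ∘ π) x₀
  have hC : twirl S q k Y = ∑ π, siteTensor S (copyPerm _ π) (C π) :=
    eq_sum_siteTensor_of_mem_commutant hmem hx₀
  have hnorm : ‖twirl S q k Y‖ ^ 2 ≤ ∑ π, ‖C π‖ * ‖E π‖ := by
    have hinner : ⟪twirl S q k Y, twirl S q k Y⟫_ℂ = ∑ π, ⟪C π, E π⟫_ℂ := by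
      rw [← inner_twirl_left, twirl_eq_self hmem, hC, sum_inner]
      simp only [Y, E, inner_sum, inner_siteTensor, inner_smul_right]
    rw [← inner_self_eq_norm_sq (𝕜 := ℂ), hinner]
    exact (Complex.re_le_norm _).trans
      ((norm_sum_le _ _).trans (Finset.sum_le_sum fun π _ => norm_inner_le_norm _ _))
  have hlower := descFactorial_mul_sum_le_norm_sum_siteTensor_copyPerm_sq C
  rw [← hC] at hlower
  set d : ℝ := ((q ^ S.card).descFactorial k : ℝ)
  have : 0 ≤ d := Nat.cast_nonneg _
  -- AM-GM, weighted so that the lower bound on `‖∑ π, π ⊗ C π‖` absorbs the `C π` terms.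
  suffices 2 * (d * ‖twirl S q k Y‖ ^ 2) ≤ d * ‖twirl S q k Y‖ ^ 2 + ∑ π, ‖E π‖ ^ 2 by linarith
  calc 2 * (d * ‖twirl S q k Y‖ ^ 2) ≤ 2 * (d * ∑ π, ‖C π‖ * ‖E π‖) := by gcongr
    _ = ∑ π, 2 * (d * ‖C π‖) * ‖E π‖ := by
        simp only [Finset.mul_sum, mul_assoc]
    _ ≤ ∑ π, ((d * ‖C π‖) ^ 2 + ‖E π‖ ^ 2) :=
        Finset.sum_le_sum fun π _ => two_mul_le_add_sq _ _
    _ = d * (d * ∑ π, ‖C π‖ ^ 2) + ∑ π, ‖E π‖ ^ 2 := by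
        rw [Finset.sum_add_distrib, ← mul_assoc, Finset.mul_sum]
        simp only [mul_pow, sq d]
    _ ≤ d * ‖twirl S q k Y‖ ^ 2 + ∑ π, ‖E π‖ ^ 2 := by gcongr

theorem descFactorial_mul_norm_twirl_sum_sitePerm_sq_le (hk : k ≤ q ^ S.card)
    (v : J → ℂ) (p : J → σ → Equiv.Perm (Fin k)) {M N : ℝ}
    (hM : ∀ i, ∑ j, ∏ s : {s // s ∉ S}, (agreeCount (Fin q) (p i s) (p j s) : ℝ) ≤ M)
    (hN : ∀ j, v j ≠ 0 →
      ∑ π, ∏ s : {s // s ∈ S}, (agreeCount (Fin q) π (p j s) : ℝ) ^ 2 ≤ N) :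
    ((q ^ S.card).descFactorial k : ℝ) * ‖twirl S q k (∑ j, v j • sitePerm q (p j))‖ ^ 2 ≤
      M * N * ∑ j, ‖v j‖ ^ 2 := by
  let α (π : Equiv.Perm (Fin k)) (j : J) : ℝ :=
    ∏ s : {s // s ∈ S}, (agreeCount (Fin q) π (p j s) : ℝ)
  let w (π : Equiv.Perm (Fin k)) (j : J) : ℂ := v j * α π j
  let B (j : J) : Op {s // s ∉ S} q k := sitePerm q fun s => p j s
  let A (j : J) : Op {s // s ∈ S} q k := sitePerm q fun s => p j s
  have hsum : ∑ j, v j • sitePerm q (p j) = ∑ j, siteTensor S (v j • A j) (B j) := by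
    refine Finset.sum_congr rfl fun j _ => ?_
    rw [siteTensor_smul_left, siteTensor_sitePerm]
  have hinner (π : Equiv.Perm (Fin k)) (j : J) : ⟪copyPerm _ π, v j • A j⟫_ℂ = w π j := by
    rw [inner_smul_right, copyPerm_eq_sitePerm, inner_sitePerm]
    simp only [w, α, Nat.cast_prod, Complex.ofReal_prod, Complex.ofReal_natCast]
  have hgram (i : J) : ∑ j, ‖⟪B i, B j⟫_ℂ‖ ≤ M := by
    simp only [B, inner_sitePerm, Complex.norm_natCast]
    exact_mod_cast hM i
  have hcolumn (j : J) : ∑ π, ‖w π j‖ ^ 2 ≤ N * ‖v j‖ ^ 2 := by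
    rcases eq_or_ne (v j) 0 with hv | hv
    · simp [w, hv]
    · simp only [w, norm_mul, mul_pow, Complex.norm_real, Real.norm_eq_abs, sq_abs,
        ← Finset.mul_sum]
      rw [mul_comm]
      refine mul_le_mul_of_nonneg_right ?_ (sq_nonneg _)
      simpa only [α, ← Finset.prod_pow] using hN j hv
  calc ((q ^ S.card).descFactorial k : ℝ) * ‖twirl S q k (∑ j, v j • sitePerm q (p j))‖ ^ 2
      ≤ ∑ π, ‖∑ j, w π j • B j‖ ^ 2 := by
        rw [hsum]
        refine (descFactorial_mul_norm_twirl_sum_sq_le hk _ B).trans_eq ?_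
        simp only [hinner]
    _ ≤ M * ∑ j, N * ‖v j‖ ^ 2 := sum_norm_sum_smul_sq_le w B hgram hcolumn
    _ = M * N * ∑ j, ‖v j‖ ^ 2 := by rw [← Finset.mul_sum, mul_assoc]

end TwirlBound

section BipartiteExpansion

variable {σ : Type*} [DecidableEq σ] [Fintype σ] {q k : ℕ} {S : Finset σ}

theorem siteTensor_copyPerm (π τ : Equiv.Perm (Fin k)) :
    siteTensor S (copyPerm ({s // s ∈ S} → Fin q) π) (copyPerm ({s // s ∉ S} → Fin q) τ) =
      sitePerm q fun s => if s ∈ S then π else τ := by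
  rw [← siteTensor_sitePerm S, copyPerm_eq_sitePerm, copyPerm_eq_sitePerm]
  congr 2 <;> funext s
  · exact (if_pos s.2).symm
  · exact (if_neg s.2).symm

theorem exists_eq_sum_sitePerm {X : Op σ q k} (hX : X ∈ commutant S q k)
    (hX' : X ∈ commutant Sᶜ q k) (hS : k ≤ q ^ S.card) (hS' : k ≤ q ^ Sᶜ.card) :
    ∃ c : Equiv.Perm (Fin k) × Equiv.Perm (Fin k) → ℂ,
      X = ∑ j, c j • sitePerm q (fun s => if s ∈ S then j.1 else j.2) ∧
      ((q ^ S.card).descFactorial k * (q ^ Sᶜ.card).descFactorial k : ℝ) * ∑ j, ‖c j‖ ^ 2 ≤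
        ‖X‖ ^ 2 := by
  obtain ⟨x₀, hx₀⟩ := exists_injective_tuple hS
  obtain ⟨y₁, hy₁⟩ := exists_injective_tuple hS'
  let y₀ (i : Fin k) : {s // s ∉ S} → Fin q := (complEquiv S q).symm (y₁ i)
  have hy₀ : Function.Injective y₀ := (complEquiv S q).symm.injective.comp hy₁
  let C (π : Equiv.Perm (Fin k)) := coBlock S X (x₀ ∘ π) x₀
  let c (j : Equiv.Perm (Fin k) × Equiv.Perm (Fin k)) : ℂ := C j.1 (y₀ ∘ j.2) y₀
  have hXC : X = ∑ π, siteTensor S (copyPerm _ π) (C π) :=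
    eq_sum_siteTensor_of_mem_commutant hX hx₀
  have hC (π : Equiv.Perm (Fin k)) : C π = ∑ τ, c (π, τ) • copyPerm _ τ :=
    eq_sum_smul_copyPerm (commute_tensorPow_coBlock hX' _ _) hy₀
  have hcard : Fintype.card ({s // s ∉ S} → Fin q) = q ^ Sᶜ.card := by
    rw [Fintype.card_congr (complEquiv S q), card_config]
  refine ⟨c, ?_, ?_⟩
  · simp only [Fintype.sum_prod_type, ← siteTensor_copyPerm, ← siteTensor_sum_smul_right, ← hC]
    exact hXC
  · calc ((q ^ S.card).descFactorial k * (q ^ Sᶜ.card).descFactorial k : ℝ) * ∑ j, ‖c j‖ ^ 2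
        = (q ^ S.card).descFactorial k *
          ∑ π, (q ^ Sᶜ.card).descFactorial k * ∑ τ, ‖c (π, τ)‖ ^ 2 := by
          rw [mul_assoc, Fintype.sum_prod_type, Finset.mul_sum]
      _ ≤ (q ^ S.card).descFactorial k * ∑ π, ‖C π‖ ^ 2 := by
          gcongr with π
          rw [hC π, ← hcard]
          exact descFactorial_mul_sum_le_norm_sum_smul_copyPerm_sq _
      _ ≤ ‖X‖ ^ 2 :=
          (descFactorial_mul_sum_le_norm_sum_siteTensor_copyPerm_sq C).trans_eq (by rw [← hXC])

theorem copyPerm_mem_commutant (π : Equiv.Perm (Fin k)) :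
    copyPerm (σ → Fin q) π ∈ commutant S q k := by
  refine mem_commutant.2 fun U => ?_
  rw [siteRep_apply]
  exact commute_tensorPow_copyPerm _ π

end BipartiteExpansion

section CrossTwirlBound

variable {σ : Type*} [DecidableEq σ] {q k l n : ℕ} {S F : Finset σ}

theorem prod_agreeCount_ite (R S : Finset σ) (q : ℕ)
    (i j : Equiv.Perm (Fin k) × Equiv.Perm (Fin k)) :
    ∏ s ∈ R, agreeCount (Fin q) (if s ∈ S then i.1 else i.2) (if s ∈ S then j.1 else j.2) =
      agreeCount (Fin q) i.1 j.1 ^ (R ∩ S).card * agreeCount (Fin q) i.2 j.2 ^ (R \ S).card := by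
  rw [← Finset.prod_inter_mul_prod_sdiff R S]
  congr 1
  · refine Finset.prod_eq_pow_card fun s hs => ?_
    rw [if_pos (Finset.mem_inter.1 hs).2, if_pos (Finset.mem_inter.1 hs).2]
  · refine Finset.prod_eq_pow_card fun s hs => ?_
    rw [if_neg (Finset.mem_sdiff.1 hs).2, if_neg (Finset.mem_sdiff.1 hs).2]

theorem sum_prod_agreeCount_eq [Fintype σ] (h₁ : (Fᶜ ∩ S).card = n) (h₂ : (Fᶜ \ S).card = n)
    (i : Equiv.Perm (Fin k) × Equiv.Perm (Fin k)) :
    ∑ j : Equiv.Perm (Fin k) × Equiv.Perm (Fin k), ∏ s : {s // s ∉ F},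
      agreeCount (Fin q) (if s.1 ∈ S then i.1 else i.2) (if s.1 ∈ S then j.1 else j.2) =
        (q ^ n).ascFactorial k ^ 2 := by
  have hprod (j : Equiv.Perm (Fin k) × Equiv.Perm (Fin k)) := prod_agreeCount_ite Fᶜ S q i j
  simp only [Finset.prod_subtype Fᶜ fun _ => Finset.mem_compl, h₁, h₂,
    ← agreeCount_fin_pow] at hprod
  simp only [hprod, Fintype.sum_prod_type, ← Finset.mul_sum, ← Finset.sum_mul, sum_agreeCount,
    Fintype.card_fin, sq]

theorem sum_prod_agreeCount_sq_add_le (h₁ : (F ∩ S).card = l) (h₂ : (F \ S).card = l)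
    {j : Equiv.Perm (Fin k) × Equiv.Perm (Fin k)} (hj : j.1 ≠ j.2) :
    ∑ π, ∏ s : {s // s ∈ F}, agreeCount (Fin q) π (if s.1 ∈ S then j.1 else j.2) ^ 2 +
      ((q ^ (2 * l)) ^ k) ^ 2 ≤ (q ^ (2 * l)).ascFactorial k ^ 2 := by
  have hprod (π : Equiv.Perm (Fin k)) := prod_agreeCount_ite F S q (π, π) j
  simp only [Finset.prod_subtype F fun _ => Iff.rfl, ite_self, h₁, h₂] at hprod
  have hsq (a : ℕ) : (a ^ l) ^ 2 = a ^ (2 * l) := by rw [← pow_mul, mul_comm]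
  have hbound := sum_agreeCount_mul_agreeCount_add_le (ι := Fin (q ^ (2 * l))) hj
  simp only [agreeCount_fin_pow, Fintype.card_fin] at hbound
  simpa only [Finset.prod_pow, hprod, mul_pow, hsq] using hbound

theorem card_inter_add_card_compl_inter [Fintype σ] (F S : Finset σ) :
    (F ∩ S).card + (Fᶜ ∩ S).card = S.card := by
  rw [Finset.inter_comm, Finset.inter_comm Fᶜ, ← Finset.sdiff_eq_inter_compl,
    Finset.card_inter_add_card_sdiff]

theorem exists_mem_commutant_univ_sub_eq_sum_sitePerm [Fintype σ] {X : Op σ q k}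
    (hX : X ∈ commutant S q k) (hX' : X ∈ commutant Sᶜ q k) (hS : k ≤ q ^ S.card)
    (hS' : k ≤ q ^ Sᶜ.card) :
    ∃ W ∈ commutant Finset.univ q k, ∃ v : Equiv.Perm (Fin k) × Equiv.Perm (Fin k) → ℂ,
      (∀ j, j.1 = j.2 → v j = 0) ∧
      X - W = ∑ j, v j • sitePerm q (fun s => if s ∈ S then j.1 else j.2) ∧
      ((q ^ S.card).descFactorial k * (q ^ Sᶜ.card).descFactorial k : ℝ) * ∑ j, ‖v j‖ ^ 2 ≤
        ‖X‖ ^ 2 := by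
  obtain ⟨c, hXc, hc⟩ := exists_eq_sum_sitePerm hX hX' hS hS'
  let v (j : Equiv.Perm (Fin k) × Equiv.Perm (Fin k)) : ℂ := if j.1 = j.2 then 0 else c j
  have hv : ∑ j, ‖v j‖ ^ 2 ≤ ∑ j, ‖c j‖ ^ 2 := by
    gcongr with j
    simp only [v]
    split_ifs <;> simp
  refine ⟨∑ π, c (π, π) • copyPerm _ π, ?_, v, fun j hj => if_pos hj, ?_, le_trans (by gcongr) hc⟩
  · exact Submodule.sum_mem _ fun π _ => Submodule.smul_mem _ _ (copyPerm_mem_commutant π)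
  · have hdiag : ∑ π, c (π, π) • copyPerm (σ → Fin q) π =
        ∑ j : Equiv.Perm (Fin k) × Equiv.Perm (Fin k),
          (if j.1 = j.2 then c j else 0) • sitePerm q fun s => if s ∈ S then j.1 else j.2 := by
      simp only [Fintype.sum_prod_type, ite_smul, zero_smul, Finset.sum_ite_eq,
        Finset.mem_univ, if_true, ite_self, copyPerm_eq_sitePerm]
    rw [hXc, hdiag, ← Finset.sum_sub_distrib]
    refine Finset.sum_congr rfl fun j _ => ?_
    rw [← sub_smul]
    congr 1
    simp only [v]
    split_ifs <;> simp

theorem descFactorial_mul_norm_twirl_sub_twirl_univ_sq_le [Fintype σ]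
    (hFS : (F ∩ S).card = l) (hFS' : (F \ S).card = l)
    (hFcS : (Fᶜ ∩ S).card = n) (hFcS' : (Fᶜ \ S).card = n)
    (hkl : k ≤ q ^ (2 * l)) (hkn : k ≤ q ^ (l + n)) {X : Op σ q k}
    (hX : X ∈ commutant S q k) (hX' : X ∈ commutant Sᶜ q k) :
    ((q ^ (2 * l)).descFactorial k * (q ^ (l + n)).descFactorial k ^ 2 : ℝ) *
        ‖twirl F q k X - twirl Finset.univ q k X‖ ^ 2 ≤
      (q ^ n).ascFactorial k ^ 2 *
        ((q ^ (2 * l)).ascFactorial k ^ 2 - (((q ^ (2 * l)) ^ k : ℕ) : ℝ) ^ 2) * ‖X‖ ^ 2 := by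
  have hF : F.card = 2 * l := by
    rw [← Finset.card_inter_add_card_sdiff F S, hFS, hFS', two_mul]
  have hS : S.card = l + n := by rw [← card_inter_add_card_compl_inter F, hFS, hFcS]
  have hS' : Sᶜ.card = l + n := by
    rw [← card_inter_add_card_compl_inter F, ← Finset.sdiff_eq_inter_compl,
      ← Finset.sdiff_eq_inter_compl, hFS', hFcS']
  obtain ⟨W, hW, v, hv, hXW, hvX⟩ :=
    exists_mem_commutant_univ_sub_eq_sum_sitePerm hX hX' (hS ▸ hkn) (hS' ▸ hkn)
  rw [hS, hS', ← sq] at hvX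
  set M : ℝ := ((q ^ n).ascFactorial k : ℝ) ^ 2
  set N : ℝ := (q ^ (2 * l)).ascFactorial k ^ 2 - (((q ^ (2 * l)) ^ k : ℕ) : ℝ) ^ 2
  have hMN : 0 ≤ M * N := by
    refine mul_nonneg (sq_nonneg _) (sub_nonneg.2 ?_)
    gcongr
    exact Nat.pow_succ_le_ascFactorial _ _
  have htwirl : ((q ^ (2 * l)).descFactorial k : ℝ) * ‖twirl F q k (X - W)‖ ^ 2 ≤
      M * N * ∑ j, ‖v j‖ ^ 2 := by
    rw [hXW, ← hF]
    refine descFactorial_mul_norm_twirl_sum_sitePerm_sq_le (hF ▸ hkl) v _ (fun i => ?_)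
      fun j hj => ?_
    · simp only [M]
      exact_mod_cast (sum_prod_agreeCount_eq hFcS hFcS' i).le
    · rw [le_sub_iff_add_le]
      exact_mod_cast sum_prod_agreeCount_sq_add_le hFS hFS' (mt (hv j) hj)
  calc _ ≤ ((q ^ (2 * l)).descFactorial k * (q ^ (l + n)).descFactorial k ^ 2 : ℝ) *
        ‖twirl F q k (X - W)‖ ^ 2 := by
        gcongr
        exact norm_twirl_sub_twirl_univ_le_norm_twirl_sub X hW
    _ = (q ^ (l + n)).descFactorial k ^ 2 *
        ((q ^ (2 * l)).descFactorial k * ‖twirl F q k (X - W)‖ ^ 2) := by ring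
    _ ≤ (q ^ (l + n)).descFactorial k ^ 2 * (M * N * ∑ j, ‖v j‖ ^ 2) := by gcongr
    _ = M * N * ((q ^ (l + n)).descFactorial k ^ 2 * ∑ j, ‖v j‖ ^ 2) := by ring
    _ ≤ M * N * ‖X‖ ^ 2 := mul_le_mul_of_nonneg_left hvX hMN

end CrossTwirlBound

section SubspaceAngle

variable {q m l k : ℕ}

theorem compl_sitesA (m : ℕ) : (sitesA m)ᶜ = sitesB m := by
  ext s
  cases s <;> simp [sitesA, sitesB]

theorem card_sitesFirst_inter_sitesA (hl : l ≤ m) : (sitesFirst m l ∩ sitesA m).card = l := by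
  have h : sitesFirst m l ∩ sitesA m =
      (Finset.univ.filter fun i : Fin m => i.val < l).map Function.Embedding.inl := by
    ext s
    cases s <;> simp [sitesA, sitesFirst]
  rw [h, Finset.card_map, Fin.card_filter_val_lt, min_eq_right hl]

theorem card_sitesFirst_sdiff_sitesA (hl : l ≤ m) : (sitesFirst m l \ sitesA m).card = l := by
  have h : sitesFirst m l \ sitesA m =
      (Finset.univ.filter fun i : Fin m => i.val < l).map Function.Embedding.inr := by
    ext s
    cases s <;> simp [sitesA, sitesFirst]
  rw [h, Finset.card_map, Fin.card_filter_val_lt, min_eq_right hl]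

theorem card_compl_sitesFirst_inter_sitesA (hl : l ≤ m) :
    ((sitesFirst m l)ᶜ ∩ sitesA m).card = m - l := by
  have h : (sitesFirst m l)ᶜ ∩ sitesA m =
      (Finset.univ.filter fun i : Fin m => i.val < l)ᶜ.map Function.Embedding.inl := by
    ext s
    cases s <;> simp [sitesA, sitesFirst]
  rw [h, Finset.card_map, Finset.card_compl, Fin.card_filter_val_lt, min_eq_right hl,
    Fintype.card_fin]

theorem card_compl_sitesFirst_sdiff_sitesA (hl : l ≤ m) :
    ((sitesFirst m l)ᶜ \ sitesA m).card = m - l := by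
  have h : (sitesFirst m l)ᶜ \ sitesA m =
      (Finset.univ.filter fun i : Fin m => i.val < l)ᶜ.map Function.Embedding.inr := by
    ext s
    cases s <;> simp [sitesA, sitesFirst]
  rw [h, Finset.card_map, Finset.card_compl, Fin.card_filter_val_lt, min_eq_right hl,
    Fintype.card_fin]

theorem subspaceAngle_sq_le {K : ℝ} (hK : 0 ≤ K)
    (h : ∀ X ∈ commutant (sitesA m) q k ⊓ commutant (sitesA m)ᶜ q k,
      ‖twirl (sitesFirst m l) q k X - twirl Finset.univ q k X‖ ^ 2 ≤ K * ‖X‖ ^ 2) :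
    subspaceAngle q m l k ^ 2 ≤ K := by
  have hbound (X : Op (Fin m ⊕ Fin m) q k) :
      ‖(crossTwirl q m l k ∘ₗ productTwirl q m k - fullTwirl q m k) X‖ ≤ √K * ‖X‖ := by
    let Y := twirl (sitesA m) q k (twirl (sitesA m)ᶜ q k X)
    have hY : Y ∈ commutant (sitesA m) q k ⊓ commutant (sitesA m)ᶜ q k :=
      ⟨twirl_mem_commutant _, twirl_mem_commutant_compl (twirl_mem_commutant X)⟩
    have hXY : (crossTwirl q m l k ∘ₗ productTwirl q m k - fullTwirl q m k) X =
        twirl (sitesFirst m l) q k Y - twirl Finset.univ q k Y := by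
      rw [twirl_univ_twirl, twirl_univ_twirl, LinearMap.sub_apply, crossTwirl, productTwirl,
        fullTwirl, ← compl_sitesA]
      rfl
    rw [hXY, ← sq_le_sq₀ (by positivity) (by positivity), mul_pow, Real.sq_sqrt hK]
    refine (h Y hY).trans ?_
    gcongr
    exact (norm_twirl_le _).trans (norm_twirl_le X)
  rw [← Real.sq_sqrt hK]
  exact pow_le_pow_left₀ (norm_nonneg _)
    (ContinuousLinearMap.opNorm_le_bound _ (Real.sqrt_nonneg K) hbound) 2

theorem subspaceAngle_sq_le_one : subspaceAngle q m l k ^ 2 ≤ 1 := by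
  refine subspaceAngle_sq_le zero_le_one fun X _ => ?_
  rw [one_mul]
  gcongr
  exact (norm_twirl_sub_twirl_univ_le X).trans (norm_twirl_le X)

theorem subspaceAngle_sq_le_div (hl : l ≤ m) (hkl : k ≤ q ^ (2 * l)) (hkm : k ≤ q ^ m) :
    subspaceAngle q m l k ^ 2 ≤
      (q ^ (m - l)).ascFactorial k ^ 2 *
        ((q ^ (2 * l)).ascFactorial k ^ 2 - (((q ^ (2 * l)) ^ k : ℕ) : ℝ) ^ 2) /
        ((q ^ (2 * l)).descFactorial k * (q ^ m).descFactorial k ^ 2) := by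
  have hpos : (0 : ℝ) < (q ^ (2 * l)).descFactorial k * (q ^ m).descFactorial k ^ 2 := by
    have := Nat.descFactorial_pos.2 hkl
    have := Nat.descFactorial_pos.2 hkm
    positivity
  have hasc : (((q ^ (2 * l)) ^ k : ℕ) : ℝ) ≤ (q ^ (2 * l)).ascFactorial k := by
    exact_mod_cast Nat.pow_succ_le_ascFactorial _ _
  have hgap : 0 ≤ ((q ^ (2 * l)).ascFactorial k : ℝ) ^ 2 - (((q ^ (2 * l)) ^ k : ℕ) : ℝ) ^ 2 :=
    sub_nonneg.2 (pow_le_pow_left₀ (Nat.cast_nonneg _) hasc 2)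
  refine subspaceAngle_sq_le (by positivity) fun X hX => ?_
  rw [div_mul_eq_mul_div, le_div_iff₀' hpos]
  have hbound := descFactorial_mul_norm_twirl_sub_twirl_univ_sq_le
    (card_sitesFirst_inter_sitesA hl) (card_sitesFirst_sdiff_sitesA hl)
    (card_compl_sitesFirst_inter_sitesA hl) (card_compl_sitesFirst_sdiff_sitesA hl) hkl
    (by rwa [Nat.add_sub_cancel' hl]) hX.1 hX.2
  rwa [Nat.add_sub_cancel' hl] at hbound

end SubspaceAngle

section FactorialRatios

/-- The normalized rising factorial `x (x + 1) ⋯ (x + k - 1) / x ^ k`, in factored form. -/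
def ascRatio (x : ℝ) (k : ℕ) : ℝ := ∏ i ∈ Finset.range k, (1 + i / x)

variable {n k : ℕ} {x y : ℝ}

theorem cast_ascFactorial (hn : 0 < n) (k : ℕ) :
    (n.ascFactorial k : ℝ) = n ^ k * ascRatio n k := by
  rw [Nat.ascFactorial_eq_prod_range, Nat.cast_prod, ascRatio, Finset.pow_eq_prod_const,
    ← Finset.prod_mul_distrib]
  refine Finset.prod_congr rfl fun i _ => ?_
  push_cast
  field_simp

theorem one_le_ascRatio (hx : 0 < x) (k : ℕ) : 1 ≤ ascRatio x k :=
  Finset.one_le_prod fun i _ => le_add_of_nonneg_right (by positivity)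

theorem ascRatio_anti (hx : 0 < x) (hxy : x ≤ y) (k : ℕ) : ascRatio y k ≤ ascRatio x k := by
  have := hx.trans_le hxy
  unfold ascRatio
  gcongr

theorem sum_range_div_le (hx : 0 < x) (k : ℕ) :
    ∑ i ∈ Finset.range k, (i : ℝ) / x ≤ (k : ℝ) ^ 2 / (2 * x) := by
  have hgauss : (∑ i ∈ Finset.range k, (i : ℝ)) * 2 ≤ (k : ℝ) ^ 2 := by
    rw [sq, ← Nat.cast_mul, ← Nat.cast_sum]
    exact_mod_cast (Finset.sum_range_id_mul_two k).trans_le (Nat.mul_le_mul_left k k.pred_le)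
  rw [← Finset.sum_div, div_le_div_iff₀ hx (by positivity)]
  nlinarith

theorem ascRatio_le_exp (hx : 0 < x) (k : ℕ) :
    ascRatio x k ≤ Real.exp ((k : ℝ) ^ 2 / (2 * x)) := by
  calc ascRatio x k ≤ ∏ i ∈ Finset.range k, Real.exp (i / x) :=
        Finset.prod_le_prod (fun i _ => by positivity) fun i _ =>
          (add_comm _ _).trans_le (Real.add_one_le_exp _)
    _ = Real.exp (∑ i ∈ Finset.range k, i / x) := (Real.exp_sum _ _).symm
    _ ≤ Real.exp ((k : ℝ) ^ 2 / (2 * x)) := Real.exp_le_exp.2 (sum_range_div_le hx k)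

theorem ascRatio_sq_le_exp (hx : 0 < x) (k : ℕ) :
    ascRatio x k ^ 2 ≤ Real.exp ((k : ℝ) ^ 2 / x) := by
  calc ascRatio x k ^ 2 ≤ Real.exp ((k : ℝ) ^ 2 / (2 * x)) ^ 2 :=
        pow_le_pow_left₀ (zero_le_one.trans (one_le_ascRatio hx k)) (ascRatio_le_exp hx k) 2
    _ = Real.exp ((k : ℝ) ^ 2 / x) := by
        rw [← Real.exp_nat_mul]
        congr 1
        field_simp
        norm_num [mul_comm]

theorem one_sub_sum_le_prod_one_sub {ι R : Type*} [CommRing R] [LinearOrder R]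
    [IsStrictOrderedRing R] {s : Finset ι} {f : ι → R} (h0 : ∀ i ∈ s, 0 ≤ f i)
    (h1 : ∀ i ∈ s, f i ≤ 1) : 1 - ∑ i ∈ s, f i ≤ ∏ i ∈ s, (1 - f i) := by
  classical
  induction s using Finset.induction_on with
  | empty => simp
  | insert a s ha ih =>
    simp only [Finset.forall_mem_insert] at h0 h1
    rw [Finset.sum_insert ha, Finset.prod_insert ha]
    have hsum : 0 ≤ ∑ i ∈ s, f i := Finset.sum_nonneg h0.2
    calc 1 - (f a + ∑ i ∈ s, f i) ≤ (1 - f a) * (1 - ∑ i ∈ s, f i) := by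
          nlinarith [mul_nonneg h0.1 hsum]
      _ ≤ (1 - f a) * ∏ i ∈ s, (1 - f i) :=
          mul_le_mul_of_nonneg_left (ih h0.2 h1.2) (sub_nonneg.2 h1.1)

theorem pow_mul_one_sub_le_descFactorial (hn : 0 < n) (hk : k ≤ n) :
    (n : ℝ) ^ k * (1 - (k : ℝ) ^ 2 / (2 * n)) ≤ n.descFactorial k := by
  have hn' : (0 : ℝ) < n := Nat.cast_pos.2 hn
  calc (n : ℝ) ^ k * (1 - (k : ℝ) ^ 2 / (2 * n))
      ≤ n ^ k * (1 - ∑ i ∈ Finset.range k, (i : ℝ) / n) := by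
        gcongr
        exact sum_range_div_le hn' k
    _ ≤ n ^ k * ∏ i ∈ Finset.range k, (1 - (i : ℝ) / n) := by
        gcongr
        refine one_sub_sum_le_prod_one_sub (fun i _ => by positivity) fun i hi => ?_
        exact div_le_one_of_le₀ (by exact_mod_cast (Finset.mem_range.1 hi).le.trans hk) hn'.le
    _ = n.descFactorial k := by
        rw [Nat.descFactorial_eq_prod_range, Nat.cast_prod, Finset.pow_eq_prod_const,
          ← Finset.prod_mul_distrib]
        refine Finset.prod_congr rfl fun i hi => ?_
        rw [Nat.cast_sub ((Finset.mem_range.1 hi).le.trans hk)]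
        field_simp

theorem le_of_sq_lt_two_mul (h : k ^ 2 < 2 * n) : k ≤ n := by
  by_contra! hn
  nlinarith

theorem one_sub_sq_div_pos (h : k ^ 2 < 2 * n) : 0 < 1 - (k : ℝ) ^ 2 / (2 * n) := by
  have hn : (0 : ℝ) < 2 * n := by exact_mod_cast Nat.zero_lt_of_lt h
  rw [sub_pos, div_lt_one hn]
  exact_mod_cast h

theorem ascFactorial_sq_mul_div_descFactorial_le {T d D : ℕ} (hdim : T ^ 2 * d = D ^ 2)
    (hkd : k ^ 2 < 2 * d) (hkD : k ^ 2 < 2 * D) :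
    (T.ascFactorial k : ℝ) ^ 2 * ((d.ascFactorial k : ℝ) ^ 2 - ((d ^ k : ℕ) : ℝ) ^ 2) /
        (d.descFactorial k * (D.descFactorial k : ℝ) ^ 2) ≤
      ((1 - (k : ℝ) ^ 2 / (2 * D)) ^ 2)⁻¹ *
        ((1 - (k : ℝ) ^ 2 / (2 * d))⁻¹ * Real.exp ((k : ℝ) ^ 2 / T) *
          (ascRatio d k ^ 2 - 1)) := by
  have hd : 0 < d := by omega
  have hD : 0 < D := by omega
  have hT : 0 < T := Nat.pos_of_ne_zero fun h => (pow_pos hD 2).ne (by simpa [h] using hdim)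
  have hd' : (0 : ℝ) < d := Nat.cast_pos.2 hd
  have : (0 : ℝ) < D := Nat.cast_pos.2 hD
  have hx := one_sub_sq_div_pos hkD
  have hy := one_sub_sq_div_pos hkd
  have hDx := pow_mul_one_sub_le_descFactorial hD (le_of_sq_lt_two_mul hkD)
  have hdy := pow_mul_one_sub_le_descFactorial hd (le_of_sq_lt_two_mul hkd)
  have hgap : 0 ≤ ascRatio d k ^ 2 - 1 := sub_nonneg.2 (one_le_pow₀ (one_le_ascRatio hd' k))
  have hdim' : ((T : ℝ) ^ k) ^ 2 * (d : ℝ) ^ k = ((D : ℝ) ^ k) ^ 2 := by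
    rw [pow_right_comm, pow_right_comm (D : ℝ), ← mul_pow]
    exact_mod_cast congrArg (· ^ k) hdim
  rw [cast_ascFactorial hT, cast_ascFactorial hd, Nat.cast_pow]
  set x := 1 - (k : ℝ) ^ 2 / (2 * D)
  set y := 1 - (k : ℝ) ^ 2 / (2 * d)
  set s := ascRatio d k
  calc ((T : ℝ) ^ k * ascRatio T k) ^ 2 * (((d : ℝ) ^ k * s) ^ 2 - ((d : ℝ) ^ k) ^ 2) /
        (d.descFactorial k * (D.descFactorial k : ℝ) ^ 2)
      = ((D : ℝ) ^ k) ^ 2 * (d : ℝ) ^ k * ascRatio T k ^ 2 * (s ^ 2 - 1) /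
        (d.descFactorial k * (D.descFactorial k : ℝ) ^ 2) := by
        rw [← hdim']
        ring
    _ ≤ ((D : ℝ) ^ k) ^ 2 * (d : ℝ) ^ k * Real.exp ((k : ℝ) ^ 2 / T) * (s ^ 2 - 1) /
        ((d : ℝ) ^ k * y * ((D : ℝ) ^ k * x) ^ 2) := by
        gcongr
        exact ascRatio_sq_le_exp (Nat.cast_pos.2 hT) k
    _ = (x ^ 2)⁻¹ * (y⁻¹ * Real.exp ((k : ℝ) ^ 2 / T) * (s ^ 2 - 1)) := by
        field_simp

end FactorialRatios

section FinalEstimates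

variable {q m l k : ℕ}

theorem subspaceAngle_sq_le_ascRatio (hl : l ≤ m) (hkl : k ^ 2 < 2 * q ^ (2 * l))
    (hkm : k ^ 2 < 2 * q ^ m) :
    subspaceAngle q m l k ^ 2 ≤
      ((1 - (k : ℝ) ^ 2 / (2 * (q : ℝ) ^ m)) ^ 2)⁻¹ *
        ((1 - (k : ℝ) ^ 2 / (2 * (q : ℝ) ^ (2 * l)))⁻¹ *
          Real.exp ((k : ℝ) ^ 2 / (q : ℝ) ^ (m - l)) *
          (ascRatio ((q : ℝ) ^ (2 * l)) k ^ 2 - 1)) := by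
  have hdim : (q ^ (m - l)) ^ 2 * q ^ (2 * l) = (q ^ m) ^ 2 := by
    rw [← pow_mul, ← pow_add, ← pow_mul]
    congr 1
    omega
  refine (subspaceAngle_sq_le_div hl (le_of_sq_lt_two_mul hkl) (le_of_sq_lt_two_mul hkm)).trans ?_
  exact_mod_cast ascFactorial_sq_mul_div_descFactorial_le hdim hkl hkm

theorem sq_one_sub_add_one_le_exp {x : ℝ} (hx : 1 ≤ x) : (1 - x) ^ 2 + 1 ≤ Real.exp (2 * x) := by
  nlinarith [Real.quadratic_le_exp_of_nonneg (mul_nonneg zero_le_two (zero_le_one.trans hx))]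

theorem subspaceAngle_sq_le_mul_sub_one (hq : 1 ≤ q) (hl : l ≤ m)
    (hkl : k ^ 2 < 2 * q ^ (2 * l)) (hkm : k ^ 2 ≠ 2 * q ^ m) :
    subspaceAngle q m l k ^ 2 ≤
      ((1 - (k : ℝ) ^ 2 / (2 * (q : ℝ) ^ m)) ^ 2)⁻¹ *
        ((1 - (k : ℝ) ^ 2 / (2 * (q : ℝ) ^ (2 * l)))⁻¹ *
          Real.exp ((k : ℝ) ^ 2 / (q : ℝ) ^ (m - l)) *
          ascRatio ((q : ℝ) ^ (2 * l)) k ^ 2 - 1) := by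
  have : (0 : ℝ) < q := Nat.cast_pos.2 hq
  have hq1 : (1 : ℝ) ≤ q := Nat.one_le_cast.2 hq
  have hc : 1 ≤ (1 - (k : ℝ) ^ 2 / (2 * (q : ℝ) ^ (2 * l)))⁻¹ := by
    have hpos := one_sub_sq_div_pos hkl
    push_cast at hpos
    exact (one_le_inv₀ hpos).2 (sub_le_self _ (by positivity))
  have hg : 1 ≤ Real.exp ((k : ℝ) ^ 2 / (q : ℝ) ^ (m - l)) := Real.one_le_exp (by positivity)
  have hA : 1 ≤ ascRatio ((q : ℝ) ^ (2 * l)) k ^ 2 :=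
    one_le_pow₀ (one_le_ascRatio (by positivity) k)
  rcases hkm.lt_or_gt with hlt | hgt
  · refine (subspaceAngle_sq_le_ascRatio hl hkl hlt).trans ?_
    gcongr
    rw [mul_sub_one]
    exact sub_le_sub_left (one_le_mul_of_one_le_of_one_le hc hg) _
  · refine subspaceAngle_sq_le_one.trans ?_
    set x : ℝ := (k : ℝ) ^ 2 / (2 * (q : ℝ) ^ m)
    have hx : 1 < x := (one_lt_div (by positivity)).2 (by exact_mod_cast hgt)
    have hxg : 2 * x ≤ (k : ℝ) ^ 2 / (q : ℝ) ^ (m - l) := by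
      rw [← mul_div_assoc, mul_div_mul_left _ _ two_ne_zero]
      gcongr
      exact Nat.sub_le m l
    rw [← div_eq_inv_mul, one_le_div (sq_pos_of_neg (sub_neg.2 hx))]
    have hexp := (sq_one_sub_add_one_le_exp hx.le).trans
      (Real.exp_le_exp.2 hxg)
    have hprod := one_le_mul_of_one_le_of_one_le hc hA
    nlinarith

theorem neg_one_le_mul_pow_sub {b s t : ℝ} (hb : 0 ≤ b) (hb1 : b ≤ 1) (hs : 0 ≤ s) (hst : s ≤ t) :
    -1 ≤ b * t ^ 4 - 2 * b * s ^ 2 := by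
  nlinarith [mul_nonneg hb (sq_nonneg (s ^ 2 - 1)),
    mul_le_mul_of_nonneg_left (pow_le_pow_left₀ hs hst 4) hb]

theorem inv_pow_mul_factorial_pow_mul_choose_pow (hq : 1 ≤ q) (n e : ℕ) :
    ((q : ℝ) ^ (e * n * k))⁻¹ * (k.factorial : ℝ) ^ e * ((q ^ n + k - 1).choose k : ℝ) ^ e =
      ascRatio ((q : ℝ) ^ n) k ^ e := by
  have : (0 : ℝ) < q := Nat.cast_pos.2 hq
  have hasc := cast_ascFactorial (Nat.pow_pos (n := n) hq) k
  rw [Nat.ascFactorial_eq_factorial_mul_choose'] at hasc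
  push_cast at hasc
  have hexp : e * n * k = n * (k * e) := by ring
  rw [mul_assoc, ← mul_pow, hasc, mul_pow, ← pow_mul, ← pow_mul, hexp,
    inv_mul_cancel_left₀ (by positivity)]

end FinalEstimates

end CrossTwirl

end

theorem mainTheorem7 (q m l k : ℕ) (hq : 1 ≤ q) (hl : l < m)
    (hk : k ≤ min (q ^ (2 * l)) (q ^ m)) (hk2 : k ^ 2 < 2 * q ^ (2 * l))
    (hne : k ^ 2 ≠ 2 * q ^ m)
    (a b c g : ℝ)
    (ha : a = ((1 - (k : ℝ) ^ 2 / (2 * (q : ℝ) ^ m)) ^ 2)⁻¹)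
    (hb : b = Real.exp (-((k : ℝ) ^ 2 / (2 * (q : ℝ) ^ (2 * m)))))
    (hc : c = (1 - (k : ℝ) ^ 2 / (2 * (q : ℝ) ^ (2 * l)))⁻¹)
    (hg : g = Real.exp ((k : ℝ) ^ 2 / (q : ℝ) ^ (m - l))) :
    CrossTwirl.subspaceAngle q m l k ^ 2 ≤
      a * c * g * ((q : ℝ) ^ (4 * l * k))⁻¹ * (k.factorial : ℝ) ^ 2
          * ((q ^ (2 * l) + k - 1).choose k : ℝ) ^ 2
        - 2 * a * b * ((q : ℝ) ^ (4 * m * k))⁻¹ * (k.factorial : ℝ) ^ 2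
          * ((q ^ (2 * m) + k - 1).choose k : ℝ) ^ 2
        + a * b * ((q : ℝ) ^ (4 * m * k))⁻¹ * (k.factorial : ℝ) ^ 4
          * ((q ^ m + k - 1).choose k : ℝ) ^ 4 := by
  have : (0 : ℝ) < q := Nat.cast_pos.2 hq
  have ha0 : 0 ≤ a := ha ▸ by positivity
  have hb1 : b ≤ 1 := hb ▸ Real.exp_le_one_iff.2 (neg_nonpos.2 (by positivity))
  have hangle := CrossTwirl.subspaceAngle_sq_le_mul_sub_one hq hl.le hk2 hne
  rw [← ha, ← hc, ← hg] at hangle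
  have hratio : CrossTwirl.ascRatio ((q : ℝ) ^ (2 * m)) k ≤ CrossTwirl.ascRatio ((q : ℝ) ^ m) k :=
    CrossTwirl.ascRatio_anti (by positivity)
      (pow_le_pow_right₀ (Nat.one_le_cast.2 hq) (Nat.le_mul_of_pos_left m two_pos)) k
  have hbounds := CrossTwirl.neg_one_le_mul_pow_sub (hb ▸ Real.exp_nonneg _) hb1
    (zero_le_one.trans (CrossTwirl.one_le_ascRatio (by positivity) k)) hratio
  have hfirst := CrossTwirl.inv_pow_mul_factorial_pow_mul_choose_pow (k := k) hq (2 * l) 2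
  have hsecond := CrossTwirl.inv_pow_mul_factorial_pow_mul_choose_pow (k := k) hq (2 * m) 2
  have hthird := CrossTwirl.inv_pow_mul_factorial_pow_mul_choose_pow (k := k) hq m 4
  rw [← mul_assoc 2 2] at hfirst hsecond
  have hsum := hangle.trans (mul_le_mul_of_nonneg_left (add_le_add_right hbounds _) ha0)
  rw [← hfirst, ← hsecond, ← hthird] at hsum
  exact hsum.trans_eq (by ring)
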